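/- **Theorem.** Let $(\mathcal N,G)$ be a smooth Hausdorff Riemannian manifold without boundary (of finite dimension, or modelled on a Hilbert space, the norm $\|v\|:=\sqrt{G(v,v)}$ inducing the topology of each tangent space), with Levi-Civita connection $\nabla$ and exponential map $\exp$. Let $U\subset\mathcal N$, let $f$ be a real function that is twice differentiable at every point of $U$ (so it is defined near every point of $U$; for open $U$ this means a twice differentiable $f:U\to\mathbb R$), let $\operatorname{grad} f$ be its Riemannian gradient and $\operatorname{Hess} f(p)[v]:=\nabla_v \operatorname{grad} f$ its Riemannian Hessian. Let $x\in U$ and $L\in\mathbb R$. For $\Delta x\in T_x\mathcal N$ in the domain of $\exp_x$, let $\gamma:[0,1]\to\mathcal N$, $\gamma(t):=\exp_x(t\Delta x)$, and let $\mathcal P_{\alpha,\beta}:T_{\gamma(\alpha)}\mathcal N\to T_{\gamma(\beta)}\mathcal N$ be the parallel transport along $\gamma$. Assume that $$\bigl\|\mathcal P_{1,0}\operatorname{Hess} f(\exp_x(\Delta x))\,\mathcal P_{0,1}-\operatorname{Hess} f(x)\bigr\|\le L\,\|\Delta x\|$$ (operator norm with respect to $G$) for all such $\Delta x$ with $\gamma([0,1])\subset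 U$. Then $$\Bigl|f(\exp_x(\Delta x))-f(x)-G(\operatorname{grad} f(x),\Delta x)-\tfrac12 G(\operatorname{Hess} f(x)\Delta x,\Delta x)\Bigr|\le \frac L6\,\|\Delta x\|^3$$ for all $\Delta x$ in the domain of $\exp_x$ with $\gamma([0,1])\subset U$. In particular, if $U$ is convex in the sense that every geodesic segment with end points in $U$ is contained in $U$, then this estimate holds for all $\Delta x$ in the domain of $\exp_x$ with $\exp_x(\Delta x)\in U$. -/

import Mathlib

noncomputable section

namespace RiemTaylor

/-- The Christoffel symbols of the first kind at `y` of a metric `g` on (an open subset of) `E`, as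
a bilinear form in `(v, w)` for a fixed `u`: `½ (∂_v g(u, w) + ∂_u g(v, w) - ∂_w g(u, v))`. -/
def christoffelForm {E : Type*} [NormedAddCommGroup E] [NormedSpace ℝ E]
    (g : E → E →L[ℝ] E →L[ℝ] ℝ) (y u : E) : E →L[ℝ] E →L[ℝ] ℝ :=
  (1 / 2 : ℝ) • ((fderiv ℝ g y).flip u + fderiv ℝ g y u - ((fderiv ℝ g y).flip u).flip)

theorem christoffelForm_apply {E : Type*} [NormedAddCommGroup E] [NormedSpace ℝ E]
    (g : E → E →L[ℝ] E →L[ℝ] ℝ) (y u v w : E) :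
    christoffelForm g y u v w = (1 / 2 : ℝ) *
      (fderiv ℝ g y v u w + fderiv ℝ g y u v w - fderiv ℝ g y w u v) := by
  simp [christoffelForm]

end RiemTaylor

end

open Set Filter Bundle Manifold
open scoped Topology ContDiff InnerProductSpace

noncomputable section

namespace RiemTaylor

variable {E : Type*} [NormedAddCommGroup E] [NormedSpace ℝ E]
  {H : Type*} [TopologicalSpace H] (I : ModelWithCorners ℝ E H)
  {M : Type*} [TopologicalSpace M] [ChartedSpace H M] [IsManifold I ∞ M]

/-- The linear map `T_p M → E` giving the components of a tangent vector at `p` in the preferred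
chart around `x`; for `p` in the domain of that chart it is the derivative of the chart at `p`. -/
def chartCoord (x p : M) : TangentSpace I p →L[ℝ] E :=
  (trivializationAt E (TangentSpace I) x).continuousLinearMapAt ℝ p

/-- The inverse map `E → T_p M`, for `p` in the domain of the preferred chart around `x`. -/
def chartVec (x p : M) : E →L[ℝ] TangentSpace I p :=
  (trivializationAt E (TangentSpace I) x).symmL ℝ p

variable [RiemannianBundle (fun x : M => TangentSpace I x)]

/-- The metric in the preferred chart around `x`: the bilinear form `g_y(u, v)`, for `y` in the
target of the chart. -/
def chartMetric (x : M) (y : E) : E →L[ℝ] E →L[ℝ] ℝ :=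
  (innerSL ℝ : TangentSpace I ((extChartAt I x).symm y) →L[ℝ]
      TangentSpace I ((extChartAt I x).symm y) →L[ℝ] ℝ).bilinearComp
    (chartVec I x ((extChartAt I x).symm y)) (chartVec I x ((extChartAt I x).symm y))

/-- The Christoffel symbols of the first kind at the centre of the preferred chart around `x`, as a
bilinear form in `(v, w)` for a fixed `u`. -/
def christoffelFirst (x : M) (u : E) : E →L[ℝ] E →L[ℝ] ℝ :=
  christoffelForm (chartMetric I x) (extChartAt I x x) u

/-- The tangent spaces are complete for the norm of the metric, as this norm induces the topology
of the model space. -/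
instance completeSpace_tangentSpace [CompleteSpace E] (x : M) :
    CompleteSpace (TangentSpace I x) := by
  have h : ∀ (u₁ u₂ : UniformSpace E) (_ : @IsUniformAddGroup E u₁ _)
      (_ : @IsUniformAddGroup E u₂ _) (_ : u₁.toTopologicalSpace = u₂.toTopologicalSpace)
      (_ : @CompleteSpace E u₁), @CompleteSpace E u₂ := by
    intro u₁ u₂ h₁ h₂ h h'
    have h₃ : u₁ = u₂ := IsUniformAddGroup.ext h₁ h₂ (by rw [h])
    rwa [← h₃]
  exact h inferInstance (inferInstance : UniformSpace (TangentSpace I x)) inferInstance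
    (inferInstance : IsUniformAddGroup (TangentSpace I x)) rfl inferInstance

variable [CompleteSpace E]

/-- The Christoffel symbols of the Levi-Civita connection at `x`, in the preferred chart around
`x`: `⟪christoffel I x u v, w⟫ = ½ (∂_v g(u, w) + ∂_u g(v, w) - ∂_w g(u, v))` for all `w`. -/
def christoffel (x : M) (u : TangentSpace I x) : TangentSpace I x →L[ℝ] TangentSpace I x :=
  InnerProductSpace.continuousLinearMapOfBilin (𝕜 := ℝ)
    ((christoffelFirst I x (chartCoord I x x u)).bilinearComp
      (chartCoord I x x) (chartCoord I x x))

theorem inner_christoffel (x : M) (u v w : TangentSpace I x) :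
    ⟪christoffel I x u v, w⟫_ℝ = christoffelFirst I x (chartCoord I x x u)
      (chartCoord I x x v) (chartCoord I x x w) :=
  InnerProductSpace.continuousLinearMapOfBilin_apply _ v w

/-- The Levi-Civita covariant derivative `v ↦ ∇_v X` of a vector field `X` at `x`: in the preferred
chart around `x` it is `∂_v X + Γ(X, v)`. -/
def covDeriv (X : ∀ p : M, TangentSpace I p) (x : M) :
    TangentSpace I x →L[ℝ] TangentSpace I x :=
  (chartVec I x x).comp
      ((fderiv ℝ (fun y : E => chartCoord I x ((extChartAt I x).symm y) (X _))
        (extChartAt I x x)).comp (chartCoord I x x))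
    + christoffel I x (X x)

/-- The Riemannian gradient: `⟪grad f x, v⟫ = df_x(v)` for all `v ∈ T_x M`. -/
def grad (f : M → ℝ) (x : M) : TangentSpace I x :=
  (InnerProductSpace.toDual ℝ (TangentSpace I x)).symm (mfderiv I 𝓘(ℝ, ℝ) f x)

/-- The Riemannian Hessian `Hess f(x) v = ∇_v grad f`. -/
def hess (f : M → ℝ) (x : M) : TangentSpace I x →L[ℝ] TangentSpace I x :=
  covDeriv I (grad I f) x

/-- `f` is twice differentiable at `x`: it is differentiable near `x`, and its gradient is
differentiable at `x`. -/
def TwiceDifferentiableAt (f : M → ℝ) (x : M) : Prop :=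
  (∀ᶠ p in 𝓝 x, MDifferentiableAt I 𝓘(ℝ, ℝ) f p) ∧
    MDifferentiableAt I I.tangent (fun p => (⟨p, grad I f p⟩ : TangentBundle I M)) x

/-- The components of a vector field `V` along a curve `γ`, in the preferred chart around
`γ t`. -/
def coordAlong (γ : ℝ → M) (V : ∀ t, TangentSpace I (γ t)) (t s : ℝ) : E :=
  chartCoord I (γ t) (γ s) (V s)

/-- The velocity `γ'(t)` of a curve `γ : [0,1] → M` (one-sided at the end points). -/
def velocity (γ : ℝ → M) (t : ℝ) : TangentSpace I (γ t) :=
  mfderivWithin 𝓘(ℝ, ℝ) I γ (Icc 0 1) t (1 : ℝ)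

/-- The covariant derivative `(D/dt) V` of a vector field `V` along a curve `γ : [0,1] → M`: in
the preferred chart around `γ t` it is `V' + Γ(V, γ')`. -/
def covDerivAlong (γ : ℝ → M) (V : ∀ t, TangentSpace I (γ t)) (t : ℝ) : TangentSpace I (γ t) :=
  chartVec I (γ t) (γ t) (derivWithin (coordAlong I γ V t) (Icc 0 1) t)
    + christoffel I (γ t) (V t) (velocity I γ t)

/-- `γ : [0,1] → M` is a geodesic. -/
def IsGeodesic (γ : ℝ → M) : Prop :=
  ContMDiffOn 𝓘(ℝ, ℝ) I 2 γ (Icc 0 1) ∧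
    ∀ t ∈ Icc (0 : ℝ) 1, covDerivAlong I γ (velocity I γ) t = 0

/-- `V` is a parallel vector field along the curve `γ : [0,1] → M`. -/
def IsParallelAlong (γ : ℝ → M) (V : ∀ t, TangentSpace I (γ t)) : Prop :=
  ∀ t ∈ Icc (0 : ℝ) 1, DifferentiableWithinAt ℝ (coordAlong I γ V t) (Icc 0 1) t ∧
    covDerivAlong I γ V t = 0

/-- `P` sends each `v ∈ T_{γ α} M` to the value at `β` of a parallel field with value `v`
at `α`. -/
def IsParallelTransport (γ : ℝ → M) (α β : ℝ)
    (P : TangentSpace I (γ α) →L[ℝ] TangentSpace I (γ β)) : Prop :=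
  ∀ v, ∃ V : ∀ t, TangentSpace I (γ t), IsParallelAlong I γ V ∧ V α = v ∧ V β = P v

open Classical in
/-- Parallel transport `P_{α,β} : T_{γ α} M → T_{γ β} M` along `γ : [0,1] → M`, for
`α, β ∈ [0,1]`. -/
def parallelTransport (γ : ℝ → M) (α β : ℝ) :
    TangentSpace I (γ α) →L[ℝ] TangentSpace I (γ β) :=
  if h : ∃ P, IsParallelTransport I γ α β P then h.choose else 0

/-- `γ : [0,1] → M` is a geodesic with `γ 0 = x` and `γ' 0 = v`. -/
def IsGeodesicFrom (x : M) (v : TangentSpace I x) (γ : ℝ → M) : Prop :=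
  IsGeodesic I γ ∧ (⟨γ 0, velocity I γ 0⟩ : TangentBundle I M) = ⟨x, v⟩

/-- The domain of `exp_x`: those `v` for which the geodesic with initial velocity `v` exists
on `[0,1]`. -/
def expDomain (x : M) : Set (TangentSpace I x) :=
  {v | ∃ γ, IsGeodesicFrom I x v γ}

open Classical in
/-- The exponential map: `exp_x v = γ 1` for the geodesic `γ` with `γ 0 = x`, `γ' 0 = v`
(and the value `x` if `v` is outside the domain of `exp_x`). -/
def expMap (x : M) (v : TangentSpace I x) : M :=
  if h : ∃ γ, IsGeodesicFrom I x v γ then h.choose 1 else x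

/-- The geodesic `t ↦ exp_x (t v)`. -/
def expCurve (x : M) (v : TangentSpace I x) (t : ℝ) : M :=
  expMap I x (t • v)

/-- Every geodesic segment with end points in `U` is contained in `U`. -/
def IsGeodesicallyConvex (U : Set M) : Prop :=
  ∀ x ∈ U, ∀ v ∈ expDomain I x, expMap I x v ∈ U → ∀ t ∈ Icc (0 : ℝ) 1, expCurve I x v t ∈ U

/-- `Hess f` is Lipschitz at `x` with constant `L` along the geodesic segments in `U` from `x`:
for `γ t = exp_x (t v)` contained in `U`, the operator norm (with respect to the metric) of
`P_{1,0} ∘ Hess f(γ 1) ∘ P_{0,1} - Hess f(γ 0)` is at most `L ‖v‖`. Here `γ 0 = exp_x 0 = x` and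
`γ 1 = exp_x v`. -/
def HessLipschitzAt (f : M → ℝ) (U : Set M) (L : ℝ) (x : M) : Prop :=
  ∀ v ∈ expDomain I x, (∀ t ∈ Icc (0 : ℝ) 1, expCurve I x v t ∈ U) →
    ‖(parallelTransport I (expCurve I x v) 1 0).comp
        ((hess I f (expCurve I x v 1)).comp (parallelTransport I (expCurve I x v) 0 1))
      - hess I f (expCurve I x v 0)‖ ≤ L * ‖v‖

end RiemTaylor

end

noncomputable section

namespace RiemTaylor

set_option maxSynthPendingDepth 3
set_option linter.unusedSectionVars false

/-! ### Calculus in a vector space: Christoffel symbols, linear equations, scalar Taylor estimate.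
-/

section Calculus

variable {E : Type*} [NormedAddCommGroup E] [NormedSpace ℝ E]

/-! Along the geodesic `γ t = exp_x (t v)` put `φ t = f (γ t)`. Then `φ' = ⟪grad f, γ'⟫`, and since
`γ'` is parallel and the connection is metric, `φ'' = ⟪Hess f γ', γ'⟫`. Parallel transport is
isometric and carries `γ' 0 = v` to `γ' t`, so `φ'' t - φ'' 0` is the quadratic form of `P Hess P -
Hess` at `v`. The hypothesis for the segment `t v` bounds it by `L ‖v‖³ t`, and the scalar estimate
`abs_sub_taylor_two_le` yields the factor `1/6`. These steps are
`IsGeodesic.hasDerivWithinAt_inner_grad`, `IsGeodesic.abs_hessQuad_sub_le` and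
`abs_hessQuad_expCurve_sub_le`.

Most of the work justifies this language. Covariant derivatives are defined in the chart around the
moving point; `covForm_transition` shows that vanishing does not depend on the chart, so
differential equations can be solved in a fixed one. Parallel transport and `exp` are defined by
choice with default values, so existence and uniqueness are needed: parallel fields exist by
Picard-Lindelöf and subdivision (`exists_isParallelAlong`) and are unique because inner products of
parallel fields are constant; geodesics are unique by a Lipschitz argument and the Hausdorff
property (`IsGeodesic.tangentLift_eq`). -/

/-- Metric compatibility of the Christoffel symbols of a symmetric form. -/
theorem christoffelForm_add_swap {g : E → E →L[ℝ] E →L[ℝ] ℝ} {y : E}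
    (hs : ∀ a u w, fderiv ℝ g y a u w = fderiv ℝ g y a w u) (a u w : E) :
    christoffelForm g y u a w + christoffelForm g y w a u = fderiv ℝ g y a u w := by
  rw [christoffelForm_apply, christoffelForm_apply, hs a w u, hs w a u, hs u a w]
  ring

/-- Transformation law of the Christoffel symbols of the first kind. -/
theorem christoffelForm_pullback {g h : E → E →L[ℝ] E →L[ℝ] ℝ} {τ : E → E} {y : E}
    (hτ : ContDiffAt ℝ 2 τ y) (hg : DifferentiableAt ℝ g (τ y)) (hh : DifferentiableAt ℝ h y)
    (hsymm : ∀ u w, g (τ y) u w = g (τ y) w u)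
    (heq : ∀ᶠ z in 𝓝 y, ∀ u w, h z u w = g (τ z) (fderiv ℝ τ z u) (fderiv ℝ τ z w))
    (u v w : E) :
    christoffelForm h y u v w =
      christoffelForm g (τ y) (fderiv ℝ τ y u) (fderiv ℝ τ y v) (fderiv ℝ τ y w) +
        g (τ y) (fderiv ℝ (fderiv ℝ τ) y v u) (fderiv ℝ τ y w) := by
  have hτ1 : DifferentiableAt ℝ τ y := hτ.differentiableAt (by norm_num)
  have hτ2 : DifferentiableAt ℝ (fderiv ℝ τ) y :=
    (hτ.fderiv_right (m := 1) (by norm_num)).differentiableAt (by norm_num)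
  have hsym2 : ∀ a b, fderiv ℝ (fderiv ℝ τ) y a b = fderiv ℝ (fderiv ℝ τ) y b a :=
    hτ.isSymmSndFDerivAt (by simp)
  -- Differentiating `h = τ^* g` gives two terms with second derivatives of `τ`. In the alternating
  -- sum below, symmetry of `g` and of the second derivative cancels all of them except twice the
  -- one in `v, u`.
  have key : ∀ a b c, fderiv ℝ h y a b c =
      fderiv ℝ g (τ y) (fderiv ℝ τ y a) (fderiv ℝ τ y b) (fderiv ℝ τ y c) +
      g (τ y) (fderiv ℝ (fderiv ℝ τ) y a b) (fderiv ℝ τ y c) +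
      g (τ y) (fderiv ℝ τ y b) (fderiv ℝ (fderiv ℝ τ) y a c) := by
    intro a b c
    have h1 := (hh.hasFDerivAt.clm_apply (hasFDerivAt_const b y)).clm_apply (hasFDerivAt_const c y)
    have hb := fun b : E => hτ2.hasFDerivAt.clm_apply (hasFDerivAt_const b y)
    have hgτ : HasFDerivAt (fun z => g (τ z)) ((fderiv ℝ g (τ y)).comp (fderiv ℝ τ y)) y :=
      HasFDerivAt.comp (g := g) y hg.hasFDerivAt hτ1.hasFDerivAt
    have h2 := (hgτ.clm_apply (hb b)).clm_apply (hb c)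
    have h3 := h2.congr_of_eventuallyEq (heq.mono fun z hz => hz b c)
    have h4 := DFunLike.congr_fun (h1.unique h3) a
    simp at h4
    linarith
  rw [christoffelForm_apply, christoffelForm_apply, key v u w, key u v w, key w u v,
    hsym2 u v, hsym2 u w, hsym2 v w,
    hsymm (fderiv ℝ τ y v) (fderiv ℝ (fderiv ℝ τ) y w u)]
  ring

variable [CompleteSpace E]

/-- A linear differential equation on a short interval has a solution with any value at any
point. -/
theorem exists_solution_linear {A : ℝ → E →L[ℝ] E} {a b t₀ K : ℝ} (ht₀ : t₀ ∈ Icc a b)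
    (hA : ContinuousOn A (Icc a b)) (hK : ∀ t ∈ Icc a b, ‖A t‖ ≤ K)
    (hlen : 2 * K * (b - a) ≤ 1) (w : E) :
    ∃ W : ℝ → E, W t₀ = w ∧ ∀ t ∈ Icc a b, HasDerivWithinAt W (A t (W t)) (Icc a b) t := by
  have hK0 : 0 ≤ K := (norm_nonneg _).trans (hK t₀ ht₀)
  lift K to NNReal using hK0
  have hw : (0 : ℝ) ≤ ‖w‖ := norm_nonneg w
  -- On the ball of radius `‖w‖` around `w` the field is at most `2 K ‖w‖`, so by `hlen` a solution
  -- cannot leave the ball.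
  have hPL : IsPicardLindelof (fun t x => A t x) (⟨t₀, ht₀⟩ : Icc a b) w ‖w‖₊ 0
      (K * (2 * ‖w‖₊)) K := by
    refine ⟨fun t ht => ?_, fun x _ => ?_, fun t ht x hx => ?_, ?_⟩
    · exact ((A t).lipschitz.weaken (hK t ht)).lipschitzOnWith
    · exact hA.clm_apply continuousOn_const
    · have hx2 : ‖x‖ ≤ 2 * ‖w‖ := by
        have h1 : ‖x - w‖ ≤ ‖w‖ := by simpa [dist_eq_norm] using hx
        have h2 : ‖x‖ ≤ ‖x - w‖ + ‖w‖ := by simpa using norm_add_le (x - w) w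
        linarith
      calc ‖A t x‖ ≤ ‖A t‖ * ‖x‖ := (A t).le_opNorm x
        _ ≤ K * (2 * ‖w‖) := mul_le_mul (hK t ht) hx2 (norm_nonneg _) K.2
        _ = _ := by simp
    · have hm : max (b - t₀) (t₀ - a) ≤ b - a := max_le (by linarith [ht₀.1]) (by linarith [ht₀.2])
      have : (K : ℝ) * (2 * ‖w‖) * max (b - t₀) (t₀ - a) ≤ K * (2 * ‖w‖) * (b - a) := by gcongr
      have h2 : 2 * (K : ℝ) * (b - a) * ‖w‖ ≤ 1 * ‖w‖ := by gcongr
      simp only [NNReal.coe_mul, coe_nnnorm, NNReal.coe_ofNat, NNReal.coe_zero, sub_zero]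
      linarith
  exact hPL.exists_eq_forall_mem_Icc_hasDerivWithinAt₀

end Calculus

/-- Taylor estimate of order two on `[0,1]`, for a second derivative that is Lipschitz at `0`. -/
theorem abs_sub_taylor_two_le {φ φ₁ φ₂ : ℝ → ℝ} {C : ℝ}
    (h1 : ∀ t ∈ Icc (0 : ℝ) 1, HasDerivWithinAt φ (φ₁ t) (Icc 0 1) t)
    (h2 : ∀ t ∈ Icc (0 : ℝ) 1, HasDerivWithinAt φ₁ (φ₂ t) (Icc 0 1) t)
    (hC : ∀ t ∈ Icc (0 : ℝ) 1, |φ₂ t - φ₂ 0| ≤ C * t) :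
    |φ 1 - φ 0 - φ₁ 0 - 1 / 2 * φ₂ 0| ≤ C / 6 := by
  have right : ∀ {ψ : ℝ → ℝ} {d t : ℝ}, t ∈ Ico (0 : ℝ) 1 → HasDerivWithinAt ψ d (Icc 0 1) t →
      HasDerivWithinAt ψ d (Ici t) t := fun ht h =>
    h.mono_of_mem_nhdsWithin (mem_of_superset (Icc_mem_nhdsGE ht.2) (Icc_subset_Icc_left ht.1))
  -- `φ₂` need not be integrable, so the bounds are obtained by comparing derivatives, once for `φ₁`
  -- and once more for `φ`.
  have first : ∀ t ∈ Icc (0 : ℝ) 1, |φ₁ t - φ₁ 0 - t * φ₂ 0| ≤ C / 2 * t ^ 2 := by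
    intro t ht
    have hd : ∀ s ∈ Icc (0 : ℝ) 1,
        HasDerivWithinAt (fun s => φ₁ s - φ₁ 0 - s * φ₂ 0) (φ₂ s - φ₂ 0) (Icc 0 1) s := by
      intro s hs
      have := ((h2 s hs).sub_const (φ₁ 0)).fun_sub ((hasDerivWithinAt_id s _).mul_const (φ₂ 0))
      exact this.congr_deriv (by simp)
    refine image_norm_le_of_norm_deriv_right_le_deriv_boundary
      (f := fun s => φ₁ s - φ₁ 0 - s * φ₂ 0) (f' := fun s => φ₂ s - φ₂ 0)
      (B := fun s => C / 2 * s ^ 2) (B' := fun s => C * s)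
      (fun s hs => (hd s hs).continuousWithinAt) (fun s hs => right hs (hd s ⟨hs.1, hs.2.le⟩))
      (by simp) (fun s => ?_) (fun s hs => hC s ⟨hs.1, hs.2.le⟩) ht
    exact ((hasDerivAt_pow 2 s).const_mul (C / 2)).congr_deriv (by push_cast; ring)
  have hd : ∀ s ∈ Icc (0 : ℝ) 1,
      HasDerivWithinAt (fun s => φ s - φ 0 - s * φ₁ 0 - s ^ 2 * (1 / 2 * φ₂ 0))
        (φ₁ s - φ₁ 0 - s * φ₂ 0) (Icc 0 1) s := fun s hs => by
    have := (((h1 s hs).sub_const (φ 0)).fun_sub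
      ((hasDerivWithinAt_id s _).mul_const (φ₁ 0))).fun_sub
      (((hasDerivAt_pow 2 s).mul_const (1 / 2 * φ₂ 0)).hasDerivWithinAt)
    exact this.congr_deriv (by push_cast; ring)
  have := image_norm_le_of_norm_deriv_right_le_deriv_boundary
      (f := fun s => φ s - φ 0 - s * φ₁ 0 - s ^ 2 * (1 / 2 * φ₂ 0))
      (f' := fun s => φ₁ s - φ₁ 0 - s * φ₂ 0)
      (B := fun s => C / 6 * s ^ 3) (B' := fun s => C / 2 * s ^ 2)
      (fun s hs => (hd s hs).continuousWithinAt) (fun s hs => right hs (hd s ⟨hs.1, hs.2.le⟩))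
      (by simp)
      (fun s => ((hasDerivAt_pow 3 s).const_mul (C / 6)).congr_deriv (by push_cast; ring))
      (fun s hs => first s ⟨hs.1, hs.2.le⟩) (right_mem_Icc.2 zero_le_one)
  simpa using this

/-! ### Tangent vectors and the metric in charts -/

section Coordinates

variable {E : Type*} [NormedAddCommGroup E] [NormedSpace ℝ E]
  {H : Type*} [TopologicalSpace H] (I : ModelWithCorners ℝ E H)
  {M : Type*} [TopologicalSpace M] [ChartedSpace H M] [IsManifold I ∞ M]

section Charts

variable {I}

theorem extChartAt_symm_apply_of_mem {x p : M} (hp : p ∈ (chartAt H x).source) :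
    (extChartAt I x).symm (extChartAt I x p) = p :=
  (extChartAt I x).left_inv (by simpa using hp)

theorem chartVec_chartCoord {x p : M} (hp : p ∈ (chartAt H x).source) (v : TangentSpace I p) :
    chartVec I x p (chartCoord I x p v) = v :=
  (trivializationAt E (TangentSpace I) x).symmL_continuousLinearMapAt (R := ℝ) (by simpa using hp) v

theorem chartCoord_chartVec {x p : M} (hp : p ∈ (chartAt H x).source) (u : E) :
    chartCoord I x p (chartVec I x p u) = u :=
  (trivializationAt E (TangentSpace I) x).continuousLinearMapAt_symmL (R := ℝ) (by simpa using hp) u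

variable (I) in
/-- The change of coordinates from the preferred chart around `x₀` to the one around `x₁`. -/
def chartTransition (x₀ x₁ : M) : E → E :=
  extChartAt I x₁ ∘ (extChartAt I x₀).symm

theorem chartTransition_apply {x₀ x₁ p : M} (hp : p ∈ (chartAt H x₀).source) :
    chartTransition I x₀ x₁ (extChartAt I x₀ p) = extChartAt I x₁ p := by
  rw [chartTransition, Function.comp_apply, extChartAt_symm_apply_of_mem hp]

variable [I.Boundaryless]

theorem contDiffAt_chartTransition {x₀ x₁ p : M} (h₀ : p ∈ (chartAt H x₀).source)
    (h₁ : p ∈ (chartAt H x₁).source) :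
    ContDiffAt ℝ ∞ (chartTransition I x₀ x₁) (extChartAt I x₀ p) := by
  have h := contDiffWithinAt_ext_coord_change (I := I) (n := ∞) x₁ x₀ (y := extChartAt I x₀ p)
    (by rw [ext_coord_change_source];
        exact ⟨chartAt H x₀ p, by simp [h₀, h₁], rfl⟩)
  rwa [I.range_eq_univ, contDiffWithinAt_univ] at h

/-- Both coordinate maps are coordinate changes from the preferred chart at `p`, so this is the
cocycle identity. -/
theorem chartCoord_eq_fderiv {x₀ x₁ p : M} (h₀ : p ∈ (chartAt H x₀).source)
    (h₁ : p ∈ (chartAt H x₁).source) (v : TangentSpace I p) :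
    chartCoord I x₁ p v =
      fderiv ℝ (chartTransition I x₀ x₁) (extChartAt I x₀ p) (chartCoord I x₀ p v) := by
  have e₀ : chartCoord I x₀ p = tangentCoordChange I p x₀ p :=
    TangentBundle.continuousLinearMapAt_trivializationAt_eq_core h₀
  have e₁ : chartCoord I x₁ p = tangentCoordChange I p x₁ p :=
    TangentBundle.continuousLinearMapAt_trivializationAt_eq_core h₁
  have hd : fderiv ℝ (chartTransition I x₀ x₁) (extChartAt I x₀ p) =
      tangentCoordChange I x₀ x₁ p := by
    rw [tangentCoordChange_def, I.range_eq_univ, fderivWithin_univ]; rfl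
  rw [hd, e₀, e₁]
  exact (tangentCoordChange_comp (I := I) (v := v)
    ⟨⟨mem_extChartAt_source p, by simpa using h₀⟩, by simpa using h₁⟩).symm

end Charts

section Metric

variable {I} [I.Boundaryless] [RiemannianBundle (fun x : M => TangentSpace I x)]

theorem chartMetric_eq_inner {x p : M} (hp : p ∈ (chartAt H x).source) (u w : E) :
    chartMetric I x (extChartAt I x p) u w = ⟪chartVec I x p u, chartVec I x p w⟫_ℝ := by
  -- The point recovered from its coordinates equals `p` only propositionally, and its tangent space
  -- depends on it; hence the variable `q`.
  have key : ∀ q, q = p →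
      ⟪chartVec I x q u, chartVec I x q w⟫_ℝ = ⟪chartVec I x p u, chartVec I x p w⟫_ℝ := by
    rintro q rfl; rfl
  exact key _ (extChartAt_symm_apply_of_mem hp)

theorem inner_eq_chartMetric {x p : M} (hp : p ∈ (chartAt H x).source) (v w : TangentSpace I p) :
    ⟪v, w⟫_ℝ = chartMetric I x (extChartAt I x p) (chartCoord I x p v) (chartCoord I x p w) := by
  rw [chartMetric_eq_inner hp, chartVec_chartCoord hp, chartVec_chartCoord hp]

theorem chartMetric_symm (x : M) (y u w : E) : chartMetric I x y u w = chartMetric I x y w u :=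
  real_inner_comm (chartVec I x ((extChartAt I x).symm y) w)
    (chartVec I x ((extChartAt I x).symm y) u)

theorem chartMetric_transition {x₀ x₁ p : M} (h₀ : p ∈ (chartAt H x₀).source)
    (h₁ : p ∈ (chartAt H x₁).source) (u w : E) :
    chartMetric I x₀ (extChartAt I x₀ p) u w =
      chartMetric I x₁ (chartTransition I x₀ x₁ (extChartAt I x₀ p))
        (fderiv ℝ (chartTransition I x₀ x₁) (extChartAt I x₀ p) u)
        (fderiv ℝ (chartTransition I x₀ x₁) (extChartAt I x₀ p) w) := by
  rw [chartTransition_apply h₀, chartMetric_eq_inner h₀, inner_eq_chartMetric h₁,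
    chartCoord_eq_fderiv h₀ h₁, chartCoord_eq_fderiv h₀ h₁, chartCoord_chartVec h₀,
    chartCoord_chartVec h₀]

theorem eventually_extChartAt_symm_mem {x p : M} (hp : p ∈ (chartAt H x).source) {s : Set M}
    (hs : s ∈ 𝓝 p) : ∀ᶠ y in 𝓝 (extChartAt I x p), y ∈ (extChartAt I x).target ∧
      (extChartAt I x).symm y ∈ s := by
  have hp' : p ∈ (extChartAt I x).source := by simpa using hp
  have h1 := extChartAt_target_mem_nhds' ((extChartAt I x).map_source hp')
  have h2 := (continuousAt_extChartAt_symm' hp').preimage_mem_nhds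
    (by rwa [extChartAt_symm_apply_of_mem hp])
  exact Filter.inter_mem h1 h2

/-- `chartMetric` is the smooth metric section read in the trivialization of the bundle of bilinear
forms at `x`. -/
theorem contDiffAt_chartMetric [IsContMDiffRiemannianBundle I ∞ E (fun x : M => TangentSpace I x)]
    {x p : M} (hp : p ∈ (chartAt H x).source) :
    ContDiffAt ℝ ∞ (chartMetric I x) (extChartAt I x p) := by
  obtain ⟨g, hg, hgi⟩ := ‹IsContMDiffRiemannianBundle I ∞ E (fun x : M => TangentSpace I x)›.1
  have h1 := (Trivialization.contMDiffAt_section_iff (trivializationAt (E →L[ℝ] E →L[ℝ] ℝ)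
    (fun x : M => TangentSpace I x →L[ℝ] TangentSpace I x →L[ℝ] ℝ) x) (x₀ := p)
    (by simpa using hp)).1 (hg p)
  have h2 : ContMDiffAt 𝓘(ℝ, E) I ∞ (extChartAt I x).symm (extChartAt I x p) :=
    (contMDiffOn_extChartAt_symm x).contMDiffAt
      (extChartAt_target_mem_nhds' ((extChartAt I x).map_source (by simpa using hp)))
  have h3 := (h1.comp_of_eq h2 (extChartAt_symm_apply_of_mem hp)).contDiffAt
  refine h3.congr_of_eventuallyEq ?_
  filter_upwards [eventually_extChartAt_symm_mem hp ((chartAt H x).open_source.mem_nhds hp)]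
    with y hy
  ext u w
  have hb : (extChartAt I x).symm y ∈ (trivializationAt E (TangentSpace I) x).baseSet := by
    simpa using hy.2
  simp only [Function.comp_apply, hom_trivializationAt_apply]
  rw [inCoordinates_apply_eq₂ hb hb (by simp)]
  refine (hgi _ (chartVec I x _ u) (chartVec I x _ w)).trans ?_
  have hv : ∀ u, chartVec I x ((extChartAt I x).symm y) u =
      (trivializationAt E (TangentSpace I) x).symm ((extChartAt I x).symm y) u := fun u =>
    Trivialization.symmL_apply _ hb u
  rw [hv, hv]
  simp

end Metric

end Coordinates

/-! ### Christoffel symbols and the covariant derivative in charts -/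

section ChartChristoffel

section Calculus

variable {E : Type*} [NormedAddCommGroup E] [NormedSpace ℝ E]

/-- `christoffelForm` as a continuous trilinear form. -/
def christoffelTrilinear (g : E → E →L[ℝ] E →L[ℝ] ℝ) (y : E) : E →L[ℝ] E →L[ℝ] E →L[ℝ] ℝ :=
  (1 / 2 : ℝ) • ((fderiv ℝ g y).flip + fderiv ℝ g y -
    ((ContinuousLinearMap.flipₗᵢ ℝ E E ℝ : (E →L[ℝ] E →L[ℝ] ℝ) ≃ₗᵢ[ℝ] _) :
      (E →L[ℝ] E →L[ℝ] ℝ) →L[ℝ] (E →L[ℝ] E →L[ℝ] ℝ)).comp (fderiv ℝ g y).flip)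

theorem christoffelTrilinear_apply (g : E → E →L[ℝ] E →L[ℝ] ℝ) (y u : E) :
    christoffelTrilinear g y u = christoffelForm g y u := by
  ext v w
  simp [christoffelTrilinear, christoffelForm]

theorem contDiffAt_christoffelTrilinear {g : E → E →L[ℝ] E →L[ℝ] ℝ} {y : E}
    (hg : ContDiffAt ℝ ∞ g y) : ContDiffAt ℝ ∞ (christoffelTrilinear g) y := by
  have h1 : ContDiffAt ℝ ∞ (fderiv ℝ g) y := hg.fderiv_right (m := ∞) (by simp)
  have h2 : ContDiffAt ℝ ∞ (fun y => (fderiv ℝ g y).flip) y :=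
    (ContinuousLinearMap.flipₗᵢ ℝ E E (E →L[ℝ] ℝ)).contDiff.contDiffAt.comp y h1
  exact ((h2.add h1).sub (contDiffAt_const.clm_comp h2)).const_smul (1 / 2 : ℝ)

theorem hasDerivWithinAt_fderiv_apply {T : E → E} {y W : ℝ → E} {η θ : E} {S : Set ℝ} {t : ℝ}
    (hT : ContDiffAt ℝ ∞ T (y t)) (hy : HasDerivWithinAt y η S t) (hW : HasDerivWithinAt W θ S t) :
    HasDerivWithinAt (fun s => fderiv ℝ T (y s) (W s))
      (fderiv ℝ (fderiv ℝ T) (y t) η (W t) + fderiv ℝ T (y t) θ) S t := by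
  have hd : DifferentiableAt ℝ (fderiv ℝ T) (y t) :=
    (hT.fderiv_right (m := 1) (by norm_cast)).differentiableAt (by norm_num)
  exact (hd.hasFDerivAt.comp_hasDerivWithinAt t hy).clm_apply hW

end Calculus

variable {E : Type*} [NormedAddCommGroup E] [NormedSpace ℝ E]
  {H : Type*} [TopologicalSpace H] (I : ModelWithCorners ℝ E H) [I.Boundaryless]
  {M : Type*} [TopologicalSpace M] [ChartedSpace H M] [IsManifold I ∞ M]
  [RiemannianBundle (fun x : M => TangentSpace I x)]

/-- The pairing with the metric of the covariant derivative `θ + Γ(W, η)`, in the preferred chart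
around `x`, of a vector field along a curve at the point with coordinates `y`; `W` and `θ` are the
coordinates of the field and their derivative, and `η` is the velocity of the curve. -/
def covForm (x : M) (y W θ η : E) : E →L[ℝ] ℝ :=
  chartMetric I x y θ + christoffelForm (chartMetric I x) y W η

variable {I}

/-- The second derivative of the transition map produced by differentiating the transformed field is
exactly the inhomogeneous term of `christoffelForm_pullback`. Pairing with the metric avoids
inverting it here. -/
theorem covForm_transition [IsContMDiffRiemannianBundle I ∞ E (fun x : M => TangentSpace I x)]
    {x₀ x₁ p : M} (h₀ : p ∈ (chartAt H x₀).source)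
    (h₁ : p ∈ (chartAt H x₁).source) (W θ η w : E) :
    covForm I x₁ (extChartAt I x₁ p)
        (fderiv ℝ (chartTransition I x₀ x₁) (extChartAt I x₀ p) W)
        (fderiv ℝ (fderiv ℝ (chartTransition I x₀ x₁)) (extChartAt I x₀ p) η W +
          fderiv ℝ (chartTransition I x₀ x₁) (extChartAt I x₀ p) θ)
        (fderiv ℝ (chartTransition I x₀ x₁) (extChartAt I x₀ p) η)
        (fderiv ℝ (chartTransition I x₀ x₁) (extChartAt I x₀ p) w) =
      covForm I x₀ (extChartAt I x₀ p) W θ η w := by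
  have hs : (chartAt H x₀).source ∩ (chartAt H x₁).source ∈ 𝓝 p :=
    ((chartAt H x₀).open_source.inter (chartAt H x₁).open_source).mem_nhds ⟨h₀, h₁⟩
  have key := christoffelForm_pullback (g := chartMetric I x₁) (h := chartMetric I x₀)
    (τ := chartTransition I x₀ x₁) (y := extChartAt I x₀ p)
    ((contDiffAt_chartTransition h₀ h₁).of_le (by norm_cast))
    (by rw [chartTransition_apply h₀]
        exact (contDiffAt_chartMetric h₁).differentiableAt (by simp))
    ((contDiffAt_chartMetric h₀).differentiableAt (by simp))
    (fun u w => chartMetric_symm _ _ _ _)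
    ((eventually_extChartAt_symm_mem h₀ hs).mono fun z hz u w => by
      have := chartMetric_transition (I := I) hz.2.1 hz.2.2 u w
      rwa [(extChartAt I x₀).right_inv hz.1] at this) W η w
  simp only [covForm, add_apply, map_add, key,
    chartMetric_transition h₀ h₁ θ w]
  rw [chartTransition_apply h₀]
  ring

variable [CompleteSpace E]

/-- In coordinates this is the Riesz isomorphism of the tangent space with its dual. -/
theorem isInvertible_chartMetric {x p : M} (hp : p ∈ (chartAt H x).source) :
    (chartMetric I x (extChartAt I x p)).IsInvertible := by
  let e : E ≃L[ℝ] TangentSpace I p := ContinuousLinearEquiv.equivOfInverse (chartVec I x p)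
    (chartCoord I x p) (chartCoord_chartVec hp) (chartVec_chartCoord hp)
  refine ⟨(e.trans (InnerProductSpace.toDual ℝ (TangentSpace I p)).toContinuousLinearEquiv).trans
    (e.symm.arrowCongr (ContinuousLinearEquiv.refl ℝ ℝ)), ?_⟩
  ext u w
  rw [chartMetric_eq_inner hp]
  rfl

variable (I) in
/-- The Christoffel symbols of the second kind in the preferred chart around `x`. -/
def chartChristoffel (x : M) (y : E) : E →L[ℝ] E →L[ℝ] E :=
  (ContinuousLinearMap.compL ℝ E (E →L[ℝ] ℝ) E (chartMetric I x y).inverse).comp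
    (christoffelTrilinear (chartMetric I x) y)

theorem contDiffAt_chartChristoffel
    [IsContMDiffRiemannianBundle I ∞ E (fun x : M => TangentSpace I x)]
    {x p : M} (hp : p ∈ (chartAt H x).source) :
    ContDiffAt ℝ ∞ (chartChristoffel I x) (extChartAt I x p) := by
  have h1 : ContDiffAt ℝ ∞ (fun y => (chartMetric I x y).inverse) (extChartAt I x p) :=
    (isInvertible_chartMetric hp).contDiffAt_map_inverse.comp _ (contDiffAt_chartMetric hp)
  exact ((ContinuousLinearMap.contDiff _).contDiffAt.comp _ h1).clm_comp
    (contDiffAt_christoffelTrilinear (contDiffAt_chartMetric hp))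

/-- Raising an index with the inverse metric turns the weak form into an explicit differential
equation. -/
theorem covForm_eq_zero_iff {x p : M} (hp : p ∈ (chartAt H x).source) (W θ η : E) :
    covForm I x (extChartAt I x p) W θ η = 0 ↔
      θ = -chartChristoffel I x (extChartAt I x p) W η := by
  have h : chartChristoffel I x (extChartAt I x p) W η =
      (chartMetric I x (extChartAt I x p)).inverse
        (christoffelForm (chartMetric I x) (extChartAt I x p) W η) := by
    simp [chartChristoffel, christoffelTrilinear_apply]
  obtain ⟨e, he⟩ := isInvertible_chartMetric (I := I) hp
  rw [h, covForm, ← he, ContinuousLinearMap.inverse_equiv, add_eq_zero_iff_eq_neg]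
  constructor
  · intro h'
    apply e.injective
    simpa using h'
  · rintro rfl
    simp

/-! ### Fields along curves -/

section Along

variable {γ : ℝ → M} {V : ∀ t, TangentSpace I (γ t)} {S : Set ℝ} {t : ℝ}

theorem hasDerivWithinAt_extChartAt_comp {x₀ : M}
    (hγ : MDifferentiableWithinAt 𝓘(ℝ, ℝ) I γ (Icc 0 1) t) (h₀ : γ t ∈ (chartAt H x₀).source) :
    HasDerivWithinAt (fun s => extChartAt I x₀ (γ s)) (chartCoord I x₀ (γ t) (velocity I γ t))
      (Icc 0 1) t := by
  have h1 : HasMFDerivAt I 𝓘(ℝ, E) (extChartAt I x₀) (γ t) (chartCoord I x₀ (γ t)) := by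
    rw [chartCoord, TangentBundle.continuousLinearMapAt_trivializationAt h₀]
    exact (mdifferentiableAt_extChartAt h₀).hasMFDerivAt
  have h2 := h1.comp_hasMFDerivWithinAt t hγ.hasMFDerivWithinAt
  have h3 : HasFDerivWithinAt (fun s => extChartAt I x₀ (γ s)) ((chartCoord I x₀ (γ t)).comp
      (mfderivWithin 𝓘(ℝ, ℝ) I γ (Icc 0 1) t) : ℝ →L[ℝ] E) (Icc 0 1) t :=
    hasMFDerivWithinAt_iff_hasFDerivWithinAt.1 h2
  exact h3.hasDerivWithinAt

theorem hasDerivWithinAt_chartCoord_change {x₀ x₁ : M} {θ η : E} (hγ : ContinuousWithinAt γ S t)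
    (h₀ : γ t ∈ (chartAt H x₀).source) (h₁ : γ t ∈ (chartAt H x₁).source)
    (hη : HasDerivWithinAt (fun s => extChartAt I x₀ (γ s)) η S t)
    (hV : HasDerivWithinAt (fun s => chartCoord I x₀ (γ s) (V s)) θ S t) :
    HasDerivWithinAt (fun s => chartCoord I x₁ (γ s) (V s))
      (fderiv ℝ (fderiv ℝ (chartTransition I x₀ x₁)) (extChartAt I x₀ (γ t)) η
          (chartCoord I x₀ (γ t) (V t)) +
        fderiv ℝ (chartTransition I x₀ x₁) (extChartAt I x₀ (γ t)) θ) S t := by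
  have hs : (chartAt H x₀).source ∩ (chartAt H x₁).source ∈ 𝓝 (γ t) :=
    ((chartAt H x₀).open_source.inter (chartAt H x₁).open_source).mem_nhds ⟨h₀, h₁⟩
  have h2 := hasDerivWithinAt_fderiv_apply (T := chartTransition I x₀ x₁)
    (y := fun s => extChartAt I x₀ (γ s)) (W := fun s => chartCoord I x₀ (γ s) (V s))
    (contDiffAt_chartTransition h₀ h₁) hη hV
  refine h2.congr_of_eventuallyEq ?_ (chartCoord_eq_fderiv h₀ h₁ (V t))
  filter_upwards [hγ hs] with s hs
  exact chartCoord_eq_fderiv hs.1 hs.2 (V s)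

variable (V) in
/-- The coordinates of `V` in the preferred chart around `x₀` satisfy at `t`, within the set `S`,
the equation `W' = -Γ(W, γ')` of parallel transport. -/
def HasParallelDerivWithinAt (x₀ : M) (S : Set ℝ) (t : ℝ) : Prop :=
  HasDerivWithinAt (fun s => chartCoord I x₀ (γ s) (V s))
    (-chartChristoffel I x₀ (extChartAt I x₀ (γ t)) (chartCoord I x₀ (γ t) (V t))
      (chartCoord I x₀ (γ t) (velocity I γ t))) S t

/-- Lets the equation be treated in one fixed chart, although parallelism is defined in the chart
around each `γ t`. -/
theorem HasParallelDerivWithinAt.change_chart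
    [IsContMDiffRiemannianBundle I ∞ E (fun x : M => TangentSpace I x)] {x₀ x₁ : M}
    (hV : HasParallelDerivWithinAt V x₀ S t)
    (hγ : MDifferentiableWithinAt 𝓘(ℝ, ℝ) I γ (Icc 0 1) t) (hS : S ⊆ Icc 0 1)
    (h₀ : γ t ∈ (chartAt H x₀).source) (h₁ : γ t ∈ (chartAt H x₁).source) :
    HasParallelDerivWithinAt V x₁ S t := by
  have hη := (hasDerivWithinAt_extChartAt_comp hγ h₀).mono hS
  have h2 := hasDerivWithinAt_chartCoord_change (x₁ := x₁) (hγ.continuousWithinAt.mono hS) h₀ h₁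
    hη hV
  refine h2.congr_deriv ((covForm_eq_zero_iff (I := I) h₁ _ _ _).1 ?_)
  have h3 := (covForm_eq_zero_iff (I := I) h₀ (chartCoord I x₀ (γ t) (V t)) _
    (chartCoord I x₀ (γ t) (velocity I γ t))).2 rfl
  ext w
  have h4 := covForm_transition (I := I) h₀ h₁ (chartCoord I x₀ (γ t) (V t))
    (-chartChristoffel I x₀ (extChartAt I x₀ (γ t)) (chartCoord I x₀ (γ t) (V t))
      (chartCoord I x₀ (γ t) (velocity I γ t))) (chartCoord I x₀ (γ t) (velocity I γ t))
      (chartCoord I x₀ (γ t) (chartVec I x₁ (γ t) w))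
  rw [h3, ← chartCoord_eq_fderiv h₀ h₁, ← chartCoord_eq_fderiv h₀ h₁, ← chartCoord_eq_fderiv h₀ h₁,
    chartCoord_chartVec h₁] at h4
  exact h4

theorem inner_covDerivAlong (w : TangentSpace I (γ t)) :
    ⟪covDerivAlong I γ V t, w⟫_ℝ = covForm I (γ t) (extChartAt I (γ t) (γ t))
      (chartCoord I (γ t) (γ t) (V t)) (derivWithin (coordAlong I γ V t) (Icc 0 1) t)
      (chartCoord I (γ t) (γ t) (velocity I γ t)) (chartCoord I (γ t) (γ t) w) := by
  rw [covDerivAlong, inner_add_left, inner_christoffel, inner_eq_chartMetric (mem_chart_source H _),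
    chartCoord_chartVec (mem_chart_source H _)]
  rfl

theorem isParallelAlong_iff : IsParallelAlong I γ V ↔
    ∀ t ∈ Icc (0 : ℝ) 1, HasParallelDerivWithinAt V (γ t) (Icc 0 1) t := by
  have hz : ∀ t, covDerivAlong I γ V t = 0 ↔ derivWithin (coordAlong I γ V t) (Icc 0 1) t =
      -chartChristoffel I (γ t) (extChartAt I (γ t) (γ t)) (chartCoord I (γ t) (γ t) (V t))
      (chartCoord I (γ t) (γ t) (velocity I γ t)) := fun t => by
    rw [← covForm_eq_zero_iff (mem_chart_source H _)]
    constructor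
    · intro h
      ext w
      have := inner_covDerivAlong (V := V) (t := t) (chartVec I (γ t) (γ t) w)
      rw [h, inner_zero_left, chartCoord_chartVec (mem_chart_source H _)] at this
      exact this.symm
    · intro h
      refine ext_inner_right ℝ fun w => ?_
      rw [inner_covDerivAlong, h, inner_zero_left]
      rfl
  refine forall₂_congr fun t ht => ?_
  rw [hz]
  constructor
  · rintro ⟨h1, h2⟩
    exact h1.hasDerivWithinAt.congr_deriv h2
  · intro h
    exact ⟨h.differentiableWithinAt, h.derivWithin (uniqueDiffOn_Icc_zero_one t ht)⟩

end Along

end ChartChristoffel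

/-! ### Compatibility with the metric -/

section MetricCompatibility

section Calculus

variable {E : Type*} [NormedAddCommGroup E] [NormedSpace ℝ E]

theorem fderiv_bilinear_symm {g : E → E →L[ℝ] E →L[ℝ] ℝ} {y : E} (hg : DifferentiableAt ℝ g y)
    (hs : ∀ z u w, g z u w = g z w u) (a u w : E) :
    fderiv ℝ g y a u w = fderiv ℝ g y a w u := by
  have h := fun u w : E =>
    (hg.hasFDerivAt.clm_apply (hasFDerivAt_const u y)).clm_apply (hasFDerivAt_const w y)
  have h1 := (h u w).unique ((h w u).congr_of_eventuallyEq (Eventually.of_forall fun z => hs z u w))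
  simpa using DFunLike.congr_fun h1 a

theorem hasDerivWithinAt_bilinear_apply {g : E → E →L[ℝ] E →L[ℝ] ℝ} {y V W : ℝ → E} {η θ κ : E}
    {S : Set ℝ} {t : ℝ} (hg : DifferentiableAt ℝ g (y t)) (hy : HasDerivWithinAt y η S t)
    (hV : HasDerivWithinAt V θ S t) (hW : HasDerivWithinAt W κ S t) :
    HasDerivWithinAt (fun s => g (y s) (V s) (W s))
      (fderiv ℝ g (y t) η (V t) (W t) + g (y t) θ (W t) + g (y t) (V t) κ) S t := by
  have h := ((hg.hasFDerivAt.comp_hasDerivWithinAt t hy).clm_apply hV).clm_apply hW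
  exact h.congr_deriv (by simp)

end Calculus

variable {E : Type*} [NormedAddCommGroup E] [NormedSpace ℝ E] [CompleteSpace E]
  {H : Type*} [TopologicalSpace H] {I : ModelWithCorners ℝ E H} [I.Boundaryless]
  {M : Type*} [TopologicalSpace M] [ChartedSpace H M] [IsManifold I ∞ M]
  [RiemannianBundle (fun x : M => TangentSpace I x)]
  {γ : ℝ → M} {V W : ∀ t, TangentSpace I (γ t)} {t : ℝ}

theorem IsParallelAlong.add (hV : IsParallelAlong I γ V) (hW : IsParallelAlong I γ W) :
    IsParallelAlong I γ (fun t => V t + W t) := by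
  rw [isParallelAlong_iff] at hV hW ⊢
  intro t ht
  unfold HasParallelDerivWithinAt
  simp only [map_add]
  exact (HasDerivWithinAt.fun_add (hV t ht) (hW t ht)).congr_deriv (by
    simp only [add_apply]; abel)

theorem IsParallelAlong.const_smul (hV : IsParallelAlong I γ V) (c : ℝ) :
    IsParallelAlong I γ (fun t => c • V t) := by
  rw [isParallelAlong_iff] at hV ⊢
  intro t ht
  unfold HasParallelDerivWithinAt
  simp only [map_smul]
  exact (HasDerivWithinAt.fun_const_smul c (hV t ht)).congr_deriv (by simp)

variable [IsContMDiffRiemannianBundle I ∞ E (fun x : M => TangentSpace I x)]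

/-- The Levi-Civita covariant derivative along curves is compatible with the metric. -/
theorem hasDerivWithinAt_inner_along (hγ : MDifferentiableWithinAt 𝓘(ℝ, ℝ) I γ (Icc 0 1) t)
    (hV : DifferentiableWithinAt ℝ (coordAlong I γ V t) (Icc 0 1) t)
    (hW : DifferentiableWithinAt ℝ (coordAlong I γ W t) (Icc 0 1) t) :
    HasDerivWithinAt (fun s => ⟪V s, W s⟫_ℝ)
      (⟪covDerivAlong I γ V t, W t⟫_ℝ + ⟪V t, covDerivAlong I γ W t⟫_ℝ) (Icc 0 1) t := by
  have hc := mem_chart_source H (γ t)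
  have hg : DifferentiableAt ℝ (chartMetric I (γ t)) (extChartAt I (γ t) (γ t)) :=
    (contDiffAt_chartMetric hc).differentiableAt (by simp)
  have h1 := hasDerivWithinAt_bilinear_apply (g := chartMetric I (γ t))
    (y := fun s => extChartAt I (γ t) (γ s)) hg (hasDerivWithinAt_extChartAt_comp hγ hc)
    hV.hasDerivWithinAt hW.hasDerivWithinAt
  have h2 := h1.congr_of_eventuallyEq (f₁ := fun s => ⟪V s, W s⟫_ℝ)
    (by
      filter_upwards [hγ.continuousWithinAt ((chartAt H (γ t)).open_source.mem_nhds hc)] with s hs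
      exact inner_eq_chartMetric hs (V s) (W s))
    (inner_eq_chartMetric hc (V t) (W t))
  refine h2.congr_deriv ?_
  rw [real_inner_comm (covDerivAlong I γ W t), inner_covDerivAlong, inner_covDerivAlong]
  -- The derivative of the metric along `γ'` is split into the Christoffel terms of the two fields.
  have h3 := christoffelForm_add_swap (fderiv_bilinear_symm hg (chartMetric_symm (I := I) (γ t)))
    (chartCoord I (γ t) (γ t) (velocity I γ t)) (chartCoord I (γ t) (γ t) (V t))
    (chartCoord I (γ t) (γ t) (W t))
  simp only [covForm, add_apply, coordAlong]
  rw [← h3, chartMetric_symm (γ t) _ (chartCoord I (γ t) (γ t) (V t))]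
  ring

/-- Parallel transport is isometric. -/
theorem IsParallelAlong.inner_eq (hγ : MDifferentiableOn 𝓘(ℝ, ℝ) I γ (Icc 0 1))
    (hV : IsParallelAlong I γ V) (hW : IsParallelAlong I γ W) {α β : ℝ}
    (hα : α ∈ Icc (0 : ℝ) 1) (hβ : β ∈ Icc (0 : ℝ) 1) :
    ⟪V α, W α⟫_ℝ = ⟪V β, W β⟫_ℝ := by
  have hd : ∀ t ∈ Icc (0 : ℝ) 1, HasDerivWithinAt (fun s => ⟪V s, W s⟫_ℝ) 0 (Icc 0 1) t :=
    fun t ht => (hasDerivWithinAt_inner_along (hγ t ht) (hV t ht).1 (hW t ht).1).congr_deriv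
      (by rw [(hV t ht).2, (hW t ht).2, inner_zero_left, inner_zero_right, add_zero])
  have h0 := constant_of_derivWithin_zero (f := fun s => ⟪V s, W s⟫_ℝ)
    (fun t ht => (hd t ht).differentiableWithinAt)
    (fun t ht => (hd t ⟨ht.1, ht.2.le⟩).derivWithin (uniqueDiffOn_Icc_zero_one t ⟨ht.1, ht.2.le⟩))
  exact (h0 α hα).trans (h0 β hβ).symm

/-- The difference of the fields is parallel, so its norm is constant, and it vanishes at `α`. No
uniqueness theorem for differential equations is needed. -/
theorem IsParallelAlong.eq_of_eq (hγ : MDifferentiableOn 𝓘(ℝ, ℝ) I γ (Icc 0 1))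
    (hV : IsParallelAlong I γ V) (hW : IsParallelAlong I γ W) {α β : ℝ}
    (hα : α ∈ Icc (0 : ℝ) 1) (hβ : β ∈ Icc (0 : ℝ) 1) (h : V α = W α) : V β = W β := by
  have hD := hV.add (hW.const_smul (-1))
  have h1 := hD.inner_eq hγ hD hα hβ
  rw [h, neg_one_smul, add_neg_cancel, inner_zero_left] at h1
  have h2 := inner_self_eq_zero.1 h1.symm
  rwa [neg_one_smul, ← sub_eq_add_neg, sub_eq_zero] at h2

end MetricCompatibility

/-! ### Parallel transport -/

section ParallelTransport

variable {E : Type*} [NormedAddCommGroup E] [NormedSpace ℝ E]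
  {H : Type*} [TopologicalSpace H] {I : ModelWithCorners ℝ E H} [I.Boundaryless]
  {M : Type*} [TopologicalSpace M] [ChartedSpace H M] [IsManifold I ∞ M]
  [RiemannianBundle (fun x : M => TangentSpace I x)] [CompleteSpace E]
  {γ : ℝ → M} {t : ℝ} {x₀ : M}

theorem contDiffWithinAt_extChartAt_comp (hγ : ContMDiffOn 𝓘(ℝ, ℝ) I 2 γ (Icc 0 1))
    (ht : t ∈ Icc (0 : ℝ) 1) (h₀ : γ t ∈ (chartAt H x₀).source) :
    ContDiffWithinAt ℝ 2 (fun s => extChartAt I x₀ (γ s)) (Icc 0 1) t := by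
  have h1 : ContMDiffAt I 𝓘(ℝ, E) 2 (extChartAt I x₀) (γ t) := contMDiffAt_extChartAt' h₀
  exact (h1.comp_contMDiffWithinAt t (hγ t ht)).contDiffWithinAt

theorem eventually_mem_chart (hγ : ContMDiffOn 𝓘(ℝ, ℝ) I 2 γ (Icc 0 1))
    (ht : t ∈ Icc (0 : ℝ) 1) (h₀ : γ t ∈ (chartAt H x₀).source) :
    ∀ᶠ s in 𝓝[Icc 0 1] t, γ s ∈ (chartAt H x₀).source :=
  (hγ t ht).continuousWithinAt ((chartAt H x₀).open_source.mem_nhds h₀)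

theorem contDiffWithinAt_chartCoord_velocity (hγ : ContMDiffOn 𝓘(ℝ, ℝ) I 2 γ (Icc 0 1))
    (ht : t ∈ Icc (0 : ℝ) 1) (h₀ : γ t ∈ (chartAt H x₀).source) :
    ContDiffWithinAt ℝ 1 (fun s => chartCoord I x₀ (γ s) (velocity I γ s)) (Icc 0 1) t := by
  have h1 := ((contDiffWithinAt_extChartAt_comp hγ ht h₀).fderivWithin_right (m := 1)
    uniqueDiffOn_Icc_zero_one (by norm_num) ht).clm_apply
      (contDiffWithinAt_const (c := (1 : ℝ)))
  have key : ∀ s ∈ Icc (0 : ℝ) 1, γ s ∈ (chartAt H x₀).source →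
      chartCoord I x₀ (γ s) (velocity I γ s) =
        fderivWithin ℝ (fun s => extChartAt I x₀ (γ s)) (Icc 0 1) s 1 := fun s hs hs' => by
    have h2 := hasDerivWithinAt_extChartAt_comp
      ((hγ s hs).mdifferentiableWithinAt (by norm_num)) hs'
    exact (h2.derivWithin (uniqueDiffOn_Icc_zero_one s hs)).symm
  refine h1.congr_of_eventuallyEq ?_ (key t ht h₀)
  filter_upwards [eventually_mem_chart hγ ht h₀, self_mem_nhdsWithin] with s hs hs'
  exact key s hs' hs

variable [IsContMDiffRiemannianBundle I ∞ E (fun x : M => TangentSpace I x)]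

variable (I γ x₀) in
/-- The coefficient `W ↦ -Γ(W, γ')` of the equation of parallel transport in a chart. -/
def transportCoeff (s : ℝ) : E →L[ℝ] E :=
  -(chartChristoffel I x₀ (extChartAt I x₀ (γ s))).flip (chartCoord I x₀ (γ s) (velocity I γ s))

theorem continuousWithinAt_transportCoeff (hγ : ContMDiffOn 𝓘(ℝ, ℝ) I 2 γ (Icc 0 1))
    (ht : t ∈ Icc (0 : ℝ) 1) (h₀ : γ t ∈ (chartAt H x₀).source) :
    ContinuousWithinAt (transportCoeff I γ x₀) (Icc 0 1) t := by
  have h1 : ContinuousWithinAt (fun s => chartChristoffel I x₀ (extChartAt I x₀ (γ s)))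
      (Icc 0 1) t :=
    ContinuousAt.comp_continuousWithinAt (f := fun s => extChartAt I x₀ (γ s))
      (contDiffAt_chartChristoffel h₀).continuousAt
      (contDiffWithinAt_extChartAt_comp hγ ht h₀).continuousWithinAt
  have h2 : ContinuousWithinAt (fun s => (chartChristoffel I x₀ (extChartAt I x₀ (γ s))).flip)
      (Icc 0 1) t :=
    (ContinuousLinearMap.flipₗᵢ ℝ E E E).continuous.continuousAt.comp_continuousWithinAt h1
  exact (h2.clm_apply (contDiffWithinAt_chartCoord_velocity hγ ht h₀).continuousWithinAt).neg

/-- The neighbourhood `O` depends only on `t₀`: it serves every subinterval, initial time and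
initial vector, as the subdivision argument requires. -/
theorem exists_parallel_local (hγ : ContMDiffOn 𝓘(ℝ, ℝ) I 2 γ (Icc 0 1)) {t₀ : ℝ}
    (ht₀ : t₀ ∈ Icc (0 : ℝ) 1) :
    ∃ O ∈ 𝓝 t₀, ∀ a b, Icc a b ⊆ Icc 0 1 → Icc a b ⊆ O → ∀ c ∈ Icc a b,
      ∀ w : TangentSpace I (γ c), ∃ V : ∀ t, TangentSpace I (γ t), V c = w ∧
        ∀ t ∈ Icc a b, HasParallelDerivWithinAt V (γ t) (Icc a b) t := by
  set x₀ := γ t₀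
  have h₀ : γ t₀ ∈ (chartAt H x₀).source := mem_chart_source H _
  -- Adding `1` makes `K` positive and the bound strict, hence valid nearby. Radius `1 / (4 * K)`
  -- keeps interval lengths at most `1 / (2 * K)`, as `exists_solution_linear` demands.
  set K := ‖transportCoeff I γ x₀ t₀‖ + 1 with hKdef
  have hK : 0 < K := by positivity
  have e1 := eventually_mem_chart hγ ht₀ h₀
  have e2 : ∀ᶠ s in 𝓝[Icc 0 1] t₀, ‖transportCoeff I γ x₀ s‖ < K :=
    (continuousWithinAt_transportCoeff hγ ht₀ h₀).norm.eventually_lt_const (by simp [hKdef])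
  have e3 : ∀ᶠ s in 𝓝 t₀, |s - t₀| < 1 / (4 * K) := by
    have := Metric.ball_mem_nhds t₀ (show 0 < 1 / (4 * K) by positivity)
    filter_upwards [this] with s hs
    simpa [Real.dist_eq] using hs
  obtain ⟨O, hO, hO'⟩ := mem_nhdsWithin_iff_exists_mem_nhds_inter.1 (e1.and e2)
  refine ⟨O ∩ {s | |s - t₀| < 1 / (4 * K)}, inter_mem hO e3, fun a b hab habO c hc w => ?_⟩
  have hmem : ∀ s ∈ Icc a b, γ s ∈ (chartAt H x₀).source := fun s hs =>
    (hO' ⟨(habO hs).1, hab hs⟩).1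
  have hle : a ≤ b := hc.1.trans hc.2
  have hlen : b - a ≤ 1 / (2 * K) := by
    have h1 : |a - t₀| < 1 / (4 * K) := (habO (left_mem_Icc.2 hle)).2
    have h2 : |b - t₀| < 1 / (4 * K) := (habO (right_mem_Icc.2 hle)).2
    have h3 : 1 / (2 * K) = 1 / (4 * K) + 1 / (4 * K) := by field_simp; norm_num
    linarith [(abs_lt.1 h1).1, (abs_lt.1 h2).2]
  obtain ⟨W, hWc, hW⟩ := exists_solution_linear (A := transportCoeff I γ x₀) (K := K) hc
    (fun s hs => (continuousWithinAt_transportCoeff hγ (hab hs) (hmem s hs)).mono hab)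
    (fun s hs => (hO' ⟨(habO hs).1, hab hs⟩).2.le)
    (by
      calc 2 * K * (b - a) ≤ 2 * K * (1 / (2 * K)) := by gcongr
        _ = 1 := by field_simp)
    (chartCoord I x₀ (γ c) w)
  refine ⟨fun s => chartVec I x₀ (γ s) (W s), ?_, fun t ht => ?_⟩
  · beta_reduce
    rw [hWc, chartVec_chartCoord (hmem c hc)]
  · refine HasParallelDerivWithinAt.change_chart (x₀ := x₀) ?_
      ((hγ t (hab ht)).mdifferentiableWithinAt (by norm_num)) hab (hmem t ht) (mem_chart_source H _)
    unfold HasParallelDerivWithinAt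
    rw [chartCoord_chartVec (hmem t ht)]
    exact (hW t ht).congr (fun s hs => chartCoord_chartVec (hmem s hs) _)
      (chartCoord_chartVec (hmem t ht) _)

/-- At `b` the one-sided derivatives agree, since the equation expresses each through the common
value there. -/
theorem exists_parallel_glue {a b c : ℝ} (hab : a ≤ b) (hbc : b ≤ c)
    {V W : ∀ t, TangentSpace I (γ t)}
    (hV : ∀ t ∈ Icc a b, HasParallelDerivWithinAt V (γ t) (Icc a b) t)
    (hW : ∀ t ∈ Icc b c, HasParallelDerivWithinAt W (γ t) (Icc b c) t) (h : V b = W b) :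
    ∃ X : ∀ t, TangentSpace I (γ t), (∀ t ∈ Icc a b, X t = V t) ∧ (∀ t ∈ Icc b c, X t = W t) ∧
      ∀ t ∈ Icc a c, HasParallelDerivWithinAt X (γ t) (Icc a c) t := by
  classical
  let X : ∀ t, TangentSpace I (γ t) := fun t => if t ≤ b then V t else W t
  have hXV : ∀ t ∈ Icc a b, X t = V t := fun t ht => if_pos ht.2
  have hXW : ∀ t ∈ Icc b c, X t = W t := fun t ht => by
    rcases ht.1.eq_or_lt with rfl | h'
    · exact (hXV b ⟨hab, le_rfl⟩).trans h
    · exact if_neg (not_le.2 h')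
  refine ⟨X, hXV, hXW, fun t ht => ?_⟩
  unfold HasParallelDerivWithinAt
  rw [← Icc_union_Icc_eq_Icc hab hbc]
  -- Off a closed interval, a derivative within it is a vacuous condition, so only the pieces
  -- containing `t` matter.
  have triv : ∀ {p q : ℝ} {F : ℝ → E} {D : E}, t ∉ Icc p q → HasDerivWithinAt F D (Icc p q) t :=
    fun h => HasFDerivWithinAt.of_notMem_closure (by rwa [isClosed_Icc.closure_eq])
  refine HasDerivWithinAt.union ?_ ?_
  · by_cases htm : t ∈ Icc a b
    · rw [hXV t htm]
      exact (hV t htm).congr (fun s hs => by rw [hXV s hs]) (by rw [hXV t htm])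
    · exact triv htm
  · by_cases htm : t ∈ Icc b c
    · rw [hXW t htm]
      exact (hW t htm).congr (fun s hs => by rw [hXW s hs]) (by rw [hXW t htm])
    · exact triv htm

/-- Parallel fields along a curve exist, with any given value at any given point. -/
theorem exists_isParallelAlong (hγ : ContMDiffOn 𝓘(ℝ, ℝ) I 2 γ (Icc 0 1)) {c : ℝ}
    (hc : c ∈ Icc (0 : ℝ) 1) (w : TangentSpace I (γ c)) :
    ∃ V : ∀ t, TangentSpace I (γ t), IsParallelAlong I γ V ∧ V c = w := by
  -- Compactness gives a finite subdivision of `[0,1]` with each piece inside one neighbourhood `O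
  -- i`.
  choose O hO hloc using fun t₀ : Icc (0 : ℝ) 1 => exists_parallel_local hγ t₀.2
  obtain ⟨t, ht0, hmono, ⟨m, hm⟩, hsub⟩ := exists_monotone_Icc_subset_open_cover_Icc
    (zero_le_one (α := ℝ)) (c := fun i : Icc (0 : ℝ) 1 => Subtype.val ⁻¹' interior (O i))
    (fun i => isOpen_interior.preimage continuous_subtype_val)
    (fun i _ => mem_iUnion.2 ⟨i, mem_interior_iff_mem_nhds.2 (hO i)⟩)
  have hcover : ∀ n, ∃ i, Icc (t n : ℝ) (t (n + 1)) ⊆ O i := fun n => by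
    obtain ⟨i, hi⟩ := hsub n
    refine ⟨i, fun s hs => interior_subset ?_⟩
    exact hi (show (⟨s, (t n).2.1.trans hs.1, hs.2.trans (t (n + 1)).2.2⟩ : Icc (0 : ℝ) 1) ∈
      Icc (t n) (t (n + 1)) from hs)
  have good : ∀ n, ∀ c ∈ Icc (0 : ℝ) (t n), ∀ w : TangentSpace I (γ c),
      ∃ V : ∀ t, TangentSpace I (γ t), V c = w ∧
        ∀ s ∈ Icc (0 : ℝ) (t n), HasParallelDerivWithinAt V (γ s) (Icc 0 (t n)) s := by
    intro n
    induction n with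
    | zero =>
      intro c hc w
      obtain ⟨i, hi⟩ := hcover 0
      refine hloc i _ _ (Icc_subset_Icc_right (t 0).2.2) (fun s hs => hi ?_) c hc w
      rw [ht0] at hs ⊢
      exact ⟨hs.1, hs.2.trans (t 1).2.1⟩
    | succ n ih =>
      intro c hc w
      obtain ⟨i, hi⟩ := hcover n
      have hle : (t n : ℝ) ≤ t (n + 1) := hmono n.le_succ
      have hloc' := hloc i _ _ (Icc_subset_Icc (t n).2.1 (t (n + 1)).2.2) hi
      -- If `c` lies in the old part, the field is extended forwards. Otherwise it is solved on the
      -- last piece and continued backwards from its value at `t n`, which is why the induction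
      -- allows every `c`.
      rcases le_total c (t n) with h | h
      · obtain ⟨V, hV, hV'⟩ := ih c ⟨hc.1, h⟩ w
        obtain ⟨W, hW, hW'⟩ := hloc' (t n) ⟨le_rfl, hle⟩ (V (t n))
        obtain ⟨X, hX, -, hX'⟩ := exists_parallel_glue (t n).2.1 hle hV' hW' hW.symm
        exact ⟨X, (hX c ⟨hc.1, h⟩).trans hV, hX'⟩
      · obtain ⟨W, hW, hW'⟩ := hloc' c ⟨h, hc.2⟩ w
        obtain ⟨V, hV, hV'⟩ := ih (t n) ⟨(t n).2.1, le_rfl⟩ (W (t n))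
        obtain ⟨X, -, hX, hX'⟩ := exists_parallel_glue (t n).2.1 hle hV' hW' hV
        exact ⟨X, (hX c ⟨h, hc.2⟩).trans hW, hX'⟩
  have h1 := good m
  rw [hm m le_rfl] at h1
  obtain ⟨V, hV, hV'⟩ := h1 c hc w
  exact ⟨V, isParallelAlong_iff.2 hV', hV⟩

/-- Parallel transport along a curve exists. -/
theorem isParallelTransport_parallelTransport (hγ : ContMDiffOn 𝓘(ℝ, ℝ) I 2 γ (Icc 0 1))
    {α β : ℝ} (hα : α ∈ Icc (0 : ℝ) 1) (hβ : β ∈ Icc (0 : ℝ) 1) :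
    IsParallelTransport I γ α β (parallelTransport I γ α β) := by
  have hd : MDifferentiableOn 𝓘(ℝ, ℝ) I γ (Icc 0 1) := hγ.mdifferentiableOn (by norm_num)
  have hex : ∃ P, IsParallelTransport I γ α β P := by
    -- The parallel fields are chosen arbitrarily: uniqueness makes the transport linear, and
    -- constancy of the norm makes it bounded by `1`.
    choose F hF hFα using fun w => exists_isParallelAlong (I := I) hγ hα w
    let T : TangentSpace I (γ α) →ₗ[ℝ] TangentSpace I (γ β) :=
      { toFun := fun w => F w β
        map_add' := fun v w => (hF (v + w)).eq_of_eq hd ((hF v).add (hF w)) hα hβ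
          (by rw [hFα, hFα, hFα])
        map_smul' := fun c w => (hF (c • w)).eq_of_eq hd ((hF w).const_smul c) hα hβ
          (by rw [hFα, hFα]) }
    refine ⟨T.mkContinuous 1 fun w => ?_, fun w => ⟨F w, hF w, hFα w, rfl⟩⟩
    have h1 := (hF w).inner_eq hd (hF w) hα hβ
    rw [hFα, real_inner_self_eq_norm_sq, real_inner_self_eq_norm_sq] at h1
    rw [one_mul]
    exact ((sq_eq_sq₀ (norm_nonneg _) (norm_nonneg _)).1 h1.symm).le
  rw [parallelTransport, dif_pos hex]
  exact hex.choose_spec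

end ParallelTransport

/-! ### Geodesics -/

section Geodesics

variable {E : Type*} [NormedAddCommGroup E] [NormedSpace ℝ E] [CompleteSpace E]
  {H : Type*} [TopologicalSpace H] {I : ModelWithCorners ℝ E H} [I.Boundaryless]
  {M : Type*} [TopologicalSpace M] [ChartedSpace H M] [IsManifold I ∞ M]
  [RiemannianBundle (fun x : M => TangentSpace I x)] {γ γ₁ γ₂ : ℝ → M} {t : ℝ} {x₀ : M}

variable (I) in
/-- The curve `t ↦ (γ t, γ' t)` in the tangent bundle. -/
def tangentLift (γ : ℝ → M) (t : ℝ) : TangentBundle I M :=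
  ⟨γ t, velocity I γ t⟩

/-- Replaces an equality between vectors in different fibres by one in the fixed space `E`. -/
theorem tangentBundle_mk_eq {p q : M} {v : TangentSpace I p} {w : TangentSpace I q}
    (hp : p ∈ (chartAt H x₀).source) (h : p = q)
    (hc : chartCoord I x₀ p v = chartCoord I x₀ q w) :
    (⟨p, v⟩ : TangentBundle I M) = ⟨q, w⟩ := by
  subst h
  rw [← chartVec_chartCoord hp v, hc, chartVec_chartCoord hp]

theorem chartCoord_velocity_eq {s r : ℝ} (h : tangentLift I γ₁ s = tangentLift I γ₂ r) (x₀ : M) :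
    chartCoord I x₀ (γ₁ s) (velocity I γ₁ s) = chartCoord I x₀ (γ₂ r) (velocity I γ₂ r) :=
  congrArg (fun p : TangentBundle I M => chartCoord I x₀ p.1 p.2) h

theorem tangentLift_congr (h : EqOn γ₁ γ₂ (Icc 0 1)) (ht : t ∈ Icc (0 : ℝ) 1) :
    tangentLift I γ₁ t = tangentLift I γ₂ t :=
  tangentMapWithin_congr (I := 𝓘(ℝ, ℝ)) (I' := I) h (⟨t, (1 : ℝ)⟩ : TangentBundle 𝓘(ℝ, ℝ) ℝ) ht

theorem velocity_rescale {r : ℝ} (hr : r ∈ Icc (0 : ℝ) 1)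
    (hγ : MDifferentiableOn 𝓘(ℝ, ℝ) I γ (Icc 0 1)) (ht : t ∈ Icc (0 : ℝ) 1) :
    velocity I (fun s => γ (r * s)) t = r • velocity I γ (r * t) := by
  have hmaps : MapsTo (fun s => r * s) (Icc (0 : ℝ) 1) (Icc 0 1) := fun s hs =>
    ⟨mul_nonneg hr.1 hs.1, mul_le_one₀ hr.2 hs.1 hs.2⟩
  have hc := mem_chart_source H (γ (r * t))
  have hlin : HasDerivWithinAt (fun s : ℝ => r * s) r (Icc 0 1) t := by
    simpa using (hasDerivWithinAt_id t (Icc (0 : ℝ) 1)).const_mul r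
  have hd : MDifferentiableOn 𝓘(ℝ, ℝ) I (fun s => γ (r * s)) (Icc 0 1) :=
    hγ.comp (fun s _ => (differentiableAt_id.const_mul r).mdifferentiableAt.mdifferentiableWithinAt)
      hmaps
  have h1 := hasDerivWithinAt_extChartAt_comp (x₀ := γ (r * t)) (hd t ht) hc
  have h2 := (hasDerivWithinAt_extChartAt_comp (x₀ := γ (r * t)) (hγ _ (hmaps ht)) hc).scomp t
    hlin hmaps
  have h3 := (uniqueDiffOn_Icc_zero_one t ht).eq_deriv _ h1 h2
  rw [← map_smul] at h3
  rw [← chartVec_chartCoord hc (velocity I (fun s => γ (r * s)) t), h3, chartVec_chartCoord hc]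

variable [IsContMDiffRiemannianBundle I ∞ E (fun x : M => TangentSpace I x)]

theorem isGeodesic_iff : IsGeodesic I γ ↔ ContMDiffOn 𝓘(ℝ, ℝ) I 2 γ (Icc 0 1) ∧
    IsParallelAlong I γ (velocity I γ) := by
  refine and_congr_right fun hγ => ⟨fun h t ht => ⟨?_, h t ht⟩, fun h t ht => (h t ht).2⟩
  exact (contDiffWithinAt_chartCoord_velocity hγ ht (mem_chart_source H _)).differentiableWithinAt
    (by norm_num)

theorem IsGeodesic.mdifferentiableOn (h : IsGeodesic I γ) :
    MDifferentiableOn 𝓘(ℝ, ℝ) I γ (Icc 0 1) :=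
  h.1.mdifferentiableOn (by norm_num)

theorem IsGeodesic.hasParallelDerivWithinAt (h : IsGeodesic I γ) (ht : t ∈ Icc (0 : ℝ) 1)
    (h₀ : γ t ∈ (chartAt H x₀).source) :
    HasParallelDerivWithinAt (velocity I γ) x₀ (Icc 0 1) t :=
  (isParallelAlong_iff.1 (isGeodesic_iff.1 h).2 t ht).change_chart (h.mdifferentiableOn t ht)
    Subset.rfl (mem_chart_source H _) h₀

/-- Needed because `expCurve` is only known to agree with a geodesic on `[0,1]`. -/
theorem IsGeodesic.congr (h : IsGeodesic I γ₁) (heq : EqOn γ₂ γ₁ (Icc 0 1)) :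
    IsGeodesic I γ₂ := by
  rw [isGeodesic_iff]
  refine ⟨h.1.congr heq, isParallelAlong_iff.2 fun t ht => ?_⟩
  have h1 := h.hasParallelDerivWithinAt (x₀ := γ₂ t) ht
    (by rw [← heq ht]; exact mem_chart_source H _)
  have hl := fun s (hs : s ∈ Icc (0 : ℝ) 1) =>
    chartCoord_velocity_eq (tangentLift_congr (I := I) heq hs) (γ₂ t)
  unfold HasParallelDerivWithinAt at h1 ⊢
  rw [← hl t ht, ← heq ht] at h1
  exact HasDerivWithinAt.congr h1 hl (hl t ht)

theorem IsGeodesic.rescale (h : IsGeodesic I γ) {r : ℝ} (hr : r ∈ Icc (0 : ℝ) 1) :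
    IsGeodesic I (fun s => γ (r * s)) := by
  have hmaps : MapsTo (fun s => r * s) (Icc (0 : ℝ) 1) (Icc 0 1) := fun s hs =>
    ⟨mul_nonneg hr.1 hs.1, mul_le_one₀ hr.2 hs.1 hs.2⟩
  have hlin : ∀ t, HasDerivWithinAt (fun s : ℝ => r * s) r (Icc 0 1) t := fun t => by
    simpa using (hasDerivWithinAt_id t (Icc (0 : ℝ) 1)).const_mul r
  rw [isGeodesic_iff]
  refine ⟨h.1.comp (contDiff_const.mul contDiff_id).contMDiff.contMDiffOn hmaps,
    isParallelAlong_iff.2 fun t ht => ?_⟩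
  have hv := fun s (hs : s ∈ Icc (0 : ℝ) 1) => velocity_rescale hr h.mdifferentiableOn hs
  have h1 := h.hasParallelDerivWithinAt (x₀ := γ (r * t)) (hmaps ht) (mem_chart_source H _)
  -- One factor `r` comes from the chain rule and one from the rescaled velocity, matching the
  -- quadratic term `Γ(γ', γ')`.
  have h2 := (HasDerivWithinAt.scomp t h1 (hlin t) hmaps).const_smul r
  unfold HasParallelDerivWithinAt
  have hcv : ∀ s ∈ Icc (0 : ℝ) 1, chartCoord I (γ (r * t)) (γ (r * s))
      (velocity I (fun s => γ (r * s)) s) =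
      r • chartCoord I (γ (r * t)) (γ (r * s)) (velocity I γ (r * s)) := fun s hs => by
    rw [hv s hs, map_smul]
  refine (h2.congr hcv (hcv t ht)).congr_deriv ?_
  rw [hcv t ht]
  simp

/-- In a chart, position and velocity solve the autonomous system `F`, which is `C¹` and so locally
Lipschitz; uniqueness is applied on a short interval to the right of `t`. -/
theorem eventually_tangentLift_eq (h₁ : IsGeodesic I γ₁) (h₂ : IsGeodesic I γ₂)
    (ht : t ∈ Ico (0 : ℝ) 1) (heq : tangentLift I γ₁ t = tangentLift I γ₂ t) :
    ∀ᶠ s in 𝓝[>] t, tangentLift I γ₁ s = tangentLift I γ₂ s := by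
  have ht' : t ∈ Icc (0 : ℝ) 1 := ⟨ht.1, ht.2.le⟩
  set x₀ := γ₁ t
  have hγ : γ₁ t = γ₂ t := congrArg TotalSpace.proj heq
  have hc₁ : γ₁ t ∈ (chartAt H x₀).source := mem_chart_source H _
  have hc₂ : γ₂ t ∈ (chartAt H x₀).source := hγ ▸ hc₁
  let z : (ℝ → M) → ℝ → E × E := fun γ s =>
    (extChartAt I x₀ (γ s), chartCoord I x₀ (γ s) (velocity I γ s))
  let F : E × E → E × E := fun p => (p.2, -chartChristoffel I x₀ p.1 p.2 p.2)
  have hzt : z γ₁ t = z γ₂ t :=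
    Prod.ext (congrArg (extChartAt I x₀) hγ) (chartCoord_velocity_eq heq x₀)
  have hz : ∀ {γ : ℝ → M}, IsGeodesic I γ → ∀ s ∈ Icc (0 : ℝ) 1, γ s ∈ (chartAt H x₀).source →
      HasDerivWithinAt (z γ) (F (z γ s)) (Icc 0 1) s := fun h s hs hsm =>
    (hasDerivWithinAt_extChartAt_comp (h.mdifferentiableOn s hs) hsm).prodMk
      (h.hasParallelDerivWithinAt hs hsm)
  have hF : ContDiffAt ℝ 1 F (z γ₁ t) := by
    have h1 : ContDiffAt ℝ 1 (fun p : E × E => chartChristoffel I x₀ p.1) (z γ₁ t) :=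
      ((contDiffAt_chartChristoffel hc₁).of_le (by norm_cast)).comp (z γ₁ t) contDiffAt_fst
    exact contDiffAt_snd.prodMk ((h1.clm_apply contDiffAt_snd).clm_apply contDiffAt_snd).neg
  obtain ⟨K, N, hN, hLip⟩ := hF.exists_lipschitzOnWith
  have ev : ∀ {γ : ℝ → M}, IsGeodesic I γ → γ t ∈ (chartAt H x₀).source → z γ t = z γ₁ t →
      ∀ᶠ s in 𝓝[Icc 0 1] t, γ s ∈ (chartAt H x₀).source ∧ z γ s ∈ N := fun h hc hzt =>
    (eventually_mem_chart h.1 ht' hc).and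
      ((hz h t ht' hc).continuousWithinAt (by rwa [hzt]))
  have ev' := (ev h₁ hc₁ rfl).and (ev h₂ hc₂ hzt.symm)
  have hnhds : 𝓝[≥] t ≤ 𝓝[Icc 0 1] t :=
    nhdsWithin_le_iff.2 (mem_of_superset (Icc_mem_nhdsGE ht.2) (Icc_subset_Icc_left ht.1))
  obtain ⟨b, htb, hb⟩ := mem_nhdsGE_iff_exists_Icc_subset.1
    (hnhds (inter_mem ev' self_mem_nhdsWithin))
  have htb' : t < b := htb
  have hmem : ∀ s ∈ Icc t b, s ∈ Icc (0 : ℝ) 1 := fun s hs => (hb hs).2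
  have right : ∀ {ψ : ℝ → E × E} {d : E × E} {s : ℝ}, s ∈ Ico t b →
      HasDerivWithinAt ψ d (Icc 0 1) s → HasDerivWithinAt ψ d (Ici s) s := fun {_ _ s} hs h =>
    h.mono_of_mem_nhdsWithin (mem_of_superset (Icc_mem_nhdsGE hs.2) fun r hr =>
      hmem r ⟨hs.1.trans hr.1, hr.2⟩)
  have hsub : Icc t b ⊆ Icc 0 1 := hmem
  have key := ODE_solution_unique_of_mem_Icc_right (v := fun _ => F) (s := fun _ => N) (K := K)
    (f := z γ₁) (g := z γ₂) (a := t) (b := b)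
    (fun _ _ => hLip)
    (fun s hs => ((hz h₁ s (hmem s hs) (hb hs).1.1.1).continuousWithinAt).mono hsub)
    (fun s hs => right hs (hz h₁ s (hmem s ⟨hs.1, hs.2.le⟩) (hb ⟨hs.1, hs.2.le⟩).1.1.1))
    (fun s hs => (hb ⟨hs.1, hs.2.le⟩).1.1.2)
    (fun s hs => ((hz h₂ s (hmem s hs) (hb hs).1.2.1).continuousWithinAt).mono hsub)
    (fun s hs => right hs (hz h₂ s (hmem s ⟨hs.1, hs.2.le⟩) (hb ⟨hs.1, hs.2.le⟩).1.2.1))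
    (fun s hs => (hb ⟨hs.1, hs.2.le⟩).1.2.2) hzt
  filter_upwards [Ioc_mem_nhdsGT htb'] with s hs
  have hsm : s ∈ Icc t b := ⟨hs.1.le, hs.2⟩
  have h1 := (hb hsm).1.1.1
  have h2 := (hb hsm).1.2.1
  refine tangentBundle_mk_eq h1 ?_ (congrArg Prod.snd (key hsm))
  exact (extChartAt I x₀).injOn (by simpa using h1) (by simpa using h2)
    (congrArg Prod.fst (key hsm))

/-- A geodesic is determined by its initial velocity. -/
theorem IsGeodesic.tangentLift_eq [T2Space M] (h₁ : IsGeodesic I γ₁) (h₂ : IsGeodesic I γ₂)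
    (h0 : tangentLift I γ₁ 0 = tangentLift I γ₂ 0) :
    ∀ t ∈ Icc (0 : ℝ) 1, tangentLift I γ₁ t = tangentLift I γ₂ t := by
  -- Continuous induction: the set of agreement is closed, by the Hausdorff property of `M` for
  -- positions and of `E` for velocities, and it extends to the right by the local result.
  have hcl : IsClosed ({t | tangentLift I γ₁ t = tangentLift I γ₂ t} ∩ Icc (0 : ℝ) 1) := by
    refine isClosed_of_closure_subset fun t ht => ?_
    have htI : t ∈ Icc (0 : ℝ) 1 :=
      closure_minimal inter_subset_right isClosed_Icc ht
    have : NeBot (𝓝[{t | tangentLift I γ₁ t = tangentLift I γ₂ t} ∩ Icc (0 : ℝ) 1] t) :=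
      mem_closure_iff_nhdsWithin_neBot.1 ht
    have hev : ∀ᶠ s in 𝓝[{t | tangentLift I γ₁ t = tangentLift I γ₂ t} ∩ Icc (0 : ℝ) 1] t,
        tangentLift I γ₁ s = tangentLift I γ₂ s :=
      eventually_nhdsWithin_of_forall fun s hs => hs.1
    have hγ : γ₁ t = γ₂ t := tendsto_nhds_unique_of_eventuallyEq
      ((h₁.1 t htI).continuousWithinAt.mono inter_subset_right).tendsto
      ((h₂.1 t htI).continuousWithinAt.mono inter_subset_right).tendsto
      (hev.mono fun s hs => congrArg TotalSpace.proj hs)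
    have hc : γ₁ t ∈ (chartAt H (γ₁ t)).source := mem_chart_source H _
    refine ⟨tangentBundle_mk_eq hc hγ ?_, htI⟩
    exact tendsto_nhds_unique_of_eventuallyEq
      ((contDiffWithinAt_chartCoord_velocity h₁.1 htI hc).continuousWithinAt.mono
        inter_subset_right).tendsto
      ((contDiffWithinAt_chartCoord_velocity h₂.1 htI (hγ ▸ hc)).continuousWithinAt.mono
        inter_subset_right).tendsto
      (hev.mono fun s hs => chartCoord_velocity_eq hs (γ₁ t))
  exact hcl.Icc_subset_of_forall_mem_nhdsWithin h0
    fun t ht => eventually_tangentLift_eq h₁ h₂ ht.2 ht.1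

/-! ### The exponential map -/

variable {x : M} {v : TangentSpace I x}

theorem IsGeodesicFrom.rescale (h : IsGeodesicFrom I x v γ) {r : ℝ} (hr : r ∈ Icc (0 : ℝ) 1) :
    IsGeodesicFrom I x (r • v) (fun s => γ (r * s)) := by
  refine ⟨h.1.rescale hr, ?_⟩
  rw [velocity_rescale hr h.1.mdifferentiableOn (left_mem_Icc.2 zero_le_one)]
  have h0 : tangentLift I γ (r * 0) = ⟨x, v⟩ := by rw [mul_zero]; exact h.2
  exact congrArg (fun p : TangentBundle I M => (⟨p.1, r • p.2⟩ : TangentBundle I M)) h0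

variable [T2Space M]

/-- By uniqueness, the geodesic chosen in `expMap` for `r • v` ends where the rescaled `γ` does. -/
theorem IsGeodesicFrom.expMap_smul (h : IsGeodesicFrom I x v γ) {r : ℝ}
    (hr : r ∈ Icc (0 : ℝ) 1) : expMap I x (r • v) = γ r := by
  have hex : ∃ γ, IsGeodesicFrom I x (r • v) γ := ⟨_, h.rescale hr⟩
  rw [expMap, dif_pos hex]
  have h1 := hex.choose_spec.1.tangentLift_eq (h.rescale hr).1
    (hex.choose_spec.2.trans (h.rescale hr).2.symm) 1 (right_mem_Icc.2 zero_le_one)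
  have h2 : hex.choose 1 = γ (r * 1) := congrArg TotalSpace.proj h1
  rwa [mul_one] at h2

theorem isGeodesicFrom_expCurve (hv : v ∈ expDomain I x) :
    IsGeodesicFrom I x v (expCurve I x v) := by
  obtain ⟨γ, hγ⟩ := hv
  have heq : EqOn (expCurve I x v) γ (Icc 0 1) := fun t ht => hγ.expMap_smul ht
  exact ⟨hγ.1.congr heq,
    (tangentLift_congr heq (left_mem_Icc.2 zero_le_one)).trans hγ.2⟩

end Geodesics

/-! ### The Taylor estimate -/

section TaylorEstimate

variable {E : Type*} [NormedAddCommGroup E] [NormedSpace ℝ E] [CompleteSpace E]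
  {H : Type*} [TopologicalSpace H] {I : ModelWithCorners ℝ E H} [I.Boundaryless]
  {M : Type*} [TopologicalSpace M] [ChartedSpace H M] [IsManifold I ∞ M]
  [RiemannianBundle (fun x : M => TangentSpace I x)]
  {γ : ℝ → M} {t : ℝ} {f : M → ℝ}

theorem inner_grad {p : M} (v : TangentSpace I p) :
    ⟪grad I f p, v⟫_ℝ = (mfderiv I 𝓘(ℝ, ℝ) f p : TangentSpace I p →L[ℝ] ℝ) v :=
  InnerProductSpace.toDual_symm_apply

theorem hasDerivWithinAt_comp_curve (hγ : MDifferentiableWithinAt 𝓘(ℝ, ℝ) I γ (Icc 0 1) t)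
    (hf : MDifferentiableAt I 𝓘(ℝ, ℝ) f (γ t)) :
    HasDerivWithinAt (fun s => f (γ s)) ⟪grad I f (γ t), velocity I γ t⟫_ℝ (Icc 0 1) t := by
  have h2 := hf.hasMFDerivAt.comp_hasMFDerivWithinAt t hγ.hasMFDerivWithinAt
  have h3 : HasFDerivWithinAt (fun s => f (γ s))
      ((mfderiv I 𝓘(ℝ, ℝ) f (γ t) : TangentSpace I (γ t) →L[ℝ] ℝ).comp
      (mfderivWithin 𝓘(ℝ, ℝ) I γ (Icc 0 1) t) : ℝ →L[ℝ] ℝ) (Icc 0 1) t :=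
    hasMFDerivWithinAt_iff_hasFDerivWithinAt.1 h2
  have key : ∀ D : ℝ →L[ℝ] ℝ, HasFDerivWithinAt (fun s => f (γ s)) D (Icc 0 1) t →
      HasDerivWithinAt (fun s => f (γ s)) (D 1) (Icc 0 1) t := fun D h => h.hasDerivWithinAt
  rw [inner_grad]
  exact key _ h3

/-- The coordinates of a differentiable vector field are differentiable. -/
theorem differentiableAt_chartCoord_section {X : ∀ p : M, TangentSpace I p} {x : M}
    (hX : MDifferentiableAt I I.tangent (fun p => (⟨p, X p⟩ : TangentBundle I M)) x) :
    DifferentiableAt ℝ (fun y : E => chartCoord I x ((extChartAt I x).symm y) (X _))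
      (extChartAt I x x) := by
  have h1 : MDifferentiableAt I 𝓘(ℝ, E)
      (fun p => (trivializationAt E (TangentSpace I) x (⟨p, X p⟩ : TangentBundle I M)).2) x :=
    ((mdifferentiableAt_totalSpace I _).1 hX).2
  have h2 : MDifferentiableAt 𝓘(ℝ, E) I (extChartAt I x).symm (extChartAt I x x) :=
    ((contMDiffOn_extChartAt_symm (n := ∞) x).contMDiffAt
      (extChartAt_target_mem_nhds x)).mdifferentiableAt (by simp)
  have h3 := (MDifferentiableAt.comp_of_eq (x := extChartAt I x x) (y := x) h1 h2
    (extChartAt_to_inv x)).differentiableAt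
  refine h3.congr_of_eventuallyEq ?_
  filter_upwards [eventually_extChartAt_symm_mem (I := I) (mem_chart_source H x)
    ((chartAt H x).open_source.mem_nhds (mem_chart_source H x))] with y hy
  exact Trivialization.continuousLinearMapAt_apply_of_mem ℝ _ hy.2 _

/-- The covariant derivative along a curve of the restriction of a vector field. -/
theorem covDerivAlong_comp {X : ∀ p : M, TangentSpace I p}
    (hγ : MDifferentiableWithinAt 𝓘(ℝ, ℝ) I γ (Icc 0 1) t) (ht : t ∈ Icc (0 : ℝ) 1)
    (hX : MDifferentiableAt I I.tangent (fun p => (⟨p, X p⟩ : TangentBundle I M)) (γ t)) :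
    DifferentiableWithinAt ℝ (coordAlong I γ (fun s => X (γ s)) t) (Icc 0 1) t ∧
      covDerivAlong I γ (fun s => X (γ s)) t = covDeriv I X (γ t) (velocity I γ t) := by
  have hc := mem_chart_source H (γ t)
  have h1 := (differentiableAt_chartCoord_section hX).hasFDerivAt.comp_hasDerivWithinAt
    (f := fun s => extChartAt I (γ t) (γ s)) t (hasDerivWithinAt_extChartAt_comp hγ hc)
  have hcoord : ∀ s, γ s ∈ (chartAt H (γ t)).source → coordAlong I γ (fun s => X (γ s)) t s =
      chartCoord I (γ t) ((extChartAt I (γ t)).symm (extChartAt I (γ t) (γ s))) (X _) :=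
    fun s hs => by rw [extChartAt_symm_apply_of_mem hs]; rfl
  have h2 := h1.congr_of_eventuallyEq (f₁ := coordAlong I γ (fun s => X (γ s)) t)
    (by
      filter_upwards [hγ.continuousWithinAt ((chartAt H (γ t)).open_source.mem_nhds hc)] with s hs
      exact hcoord s hs) (hcoord t hc)
  refine ⟨h2.differentiableWithinAt, ?_⟩
  rw [covDerivAlong, h2.derivWithin (uniqueDiffOn_Icc_zero_one t ht)]
  rfl

variable [IsContMDiffRiemannianBundle I ∞ E (fun x : M => TangentSpace I x)]

variable (I f) in
/-- The quadratic form of the Hessian, as a function on the tangent bundle. -/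
def hessQuad (p : TangentBundle I M) : ℝ :=
  ⟪hess I f p.1 p.2, p.2⟫_ℝ

/-- In the product rule the term containing the covariant derivative of `γ'` vanishes. -/
theorem IsGeodesic.hasDerivWithinAt_inner_grad (h : IsGeodesic I γ) (ht : t ∈ Icc (0 : ℝ) 1)
    (hf : TwiceDifferentiableAt I f (γ t)) :
    HasDerivWithinAt (fun s => ⟪grad I f (γ s), velocity I γ s⟫_ℝ)
      (hessQuad I f (tangentLift I γ t)) (Icc 0 1) t := by
  have hγ := h.mdifferentiableOn t ht
  obtain ⟨h1, h2⟩ := covDerivAlong_comp hγ ht hf.2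
  have h3 := hasDerivWithinAt_inner_along hγ h1 ((isGeodesic_iff.1 h).2 t ht).1
  rw [h.2 t ht, inner_zero_right, add_zero, h2] at h3
  exact h3

/-- The velocity is parallel, so `P_{0,1}` maps `γ' 0` to `γ' 1`, and by isometry pairing `P_{1,0}
w` with `γ' 0` equals pairing `w` with `γ' 1`. The difference is thus a value of one quadratic form
at `γ' 0`. -/
theorem IsGeodesic.abs_hessQuad_sub_le (h : IsGeodesic I γ) {K : ℝ}
    (hK : ‖(parallelTransport I γ 1 0).comp ((hess I f (γ 1)).comp (parallelTransport I γ 0 1))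
      - hess I f (γ 0)‖ ≤ K) :
    |hessQuad I f (tangentLift I γ 1) - hessQuad I f (tangentLift I γ 0)| ≤
      K * ‖velocity I γ 0‖ ^ 2 := by
  have h0 : (0 : ℝ) ∈ Icc (0 : ℝ) 1 := left_mem_Icc.2 zero_le_one
  have h1 : (1 : ℝ) ∈ Icc (0 : ℝ) 1 := right_mem_Icc.2 zero_le_one
  have hγ := h.mdifferentiableOn
  have hpar := (isGeodesic_iff.1 h).2
  have hP : parallelTransport I γ 0 1 (velocity I γ 0) = velocity I γ 1 := by
    obtain ⟨V, hV, hV0, hV1⟩ := isParallelTransport_parallelTransport h.1 h0 h1 (velocity I γ 0)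
    rw [← hV1]
    exact hV.eq_of_eq hγ hpar h0 h1 hV0
  have hQ : ∀ w, ⟪parallelTransport I γ 1 0 w, velocity I γ 0⟫_ℝ = ⟪w, velocity I γ 1⟫_ℝ := by
    intro w
    obtain ⟨V, hV, hV1, hV0⟩ := isParallelTransport_parallelTransport h.1 h1 h0 w
    rw [← hV0, ← hV1]
    exact hV.inner_eq hγ hpar h0 h1
  set D := (parallelTransport I γ 1 0).comp ((hess I f (γ 1)).comp (parallelTransport I γ 0 1))
      - hess I f (γ 0) with hD
  have hquad : hessQuad I f (tangentLift I γ 1) - hessQuad I f (tangentLift I γ 0) =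
      ⟪D (velocity I γ 0), velocity I γ 0⟫_ℝ := by
    have hDv : D (velocity I γ 0) =
        parallelTransport I γ 1 0 (hess I f (γ 1) (velocity I γ 1)) -
          hess I f (γ 0) (velocity I γ 0) := by
      rw [← hP]; rfl
    rw [hDv, inner_sub_left, hQ]
    rfl
  rw [hquad]
  calc |⟪D (velocity I γ 0), velocity I γ 0⟫_ℝ|
      ≤ ‖D (velocity I γ 0)‖ * ‖velocity I γ 0‖ := abs_real_inner_le_norm _ _
    _ ≤ ‖D‖ * ‖velocity I γ 0‖ * ‖velocity I γ 0‖ := by gcongr; exact D.le_opNorm _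
    _ = ‖D‖ * ‖velocity I γ 0‖ ^ 2 := by ring
    _ ≤ K * ‖velocity I γ 0‖ ^ 2 := by gcongr

variable [T2Space M] {x : M} {v : TangentSpace I x} {U : Set M} {L : ℝ}

/-- The hypothesis is applied to the shorter segment `t • v`, giving `L ‖t v‖³`. Its velocities are
`t` times those of the full curve, so a factor `t²` divides out and a linear bound in `t` remains.
-/
theorem abs_hessQuad_expCurve_sub_le (hL : HessLipschitzAt I f U L x) (hv : v ∈ expDomain I x)
    (hU : ∀ t ∈ Icc (0 : ℝ) 1, expCurve I x v t ∈ U) (ht : t ∈ Icc (0 : ℝ) 1) :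
    |hessQuad I f (tangentLift I (expCurve I x v) t) - hessQuad I f ⟨x, v⟩| ≤
      L * ‖v‖ ^ 3 * t := by
  have hc := isGeodesicFrom_expCurve hv
  -- The case `t = 0` is separate because `t ^ 2` is cancelled below.
  rcases ht.1.eq_or_lt with rfl | hpos
  · rw [show tangentLift I (expCurve I x v) 0 = ⟨x, v⟩ from hc.2]
    simp
  have hr := hc.rescale ht
  have hdom : t • v ∈ expDomain I x := ⟨_, hr⟩
  have hcurve : expCurve I x (t • v) = fun s => expCurve I x v (t * s) := by
    funext s
    rw [expCurve, expCurve, smul_smul, mul_comm]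
  have h1 := hL (t • v) hdom (fun s hs => by
    rw [hcurve]
    exact hU _ ⟨mul_nonneg ht.1 hs.1, mul_le_one₀ ht.2 hs.1 hs.2⟩)
  rw [hcurve] at h1
  have h2 := hr.1.abs_hessQuad_sub_le h1
  have hq : ∀ p : TangentBundle I M, hessQuad I f ⟨p.1, t • p.2⟩ = t ^ 2 * hessQuad I f p := by
    intro p
    simp only [hessQuad, map_smul, inner_smul_left, inner_smul_right]
    simp
    ring
  have e0 : tangentLift I (fun s => expCurve I x v (t * s)) 0 = ⟨x, t • v⟩ := hr.2
  have e1 : tangentLift I (fun s => expCurve I x v (t * s)) 1 =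
      ⟨(tangentLift I (expCurve I x v) t).1, t • (tangentLift I (expCurve I x v) t).2⟩ := by
    have : tangentLift I (fun s => expCurve I x v (t * s)) 1 =
        ⟨(tangentLift I (expCurve I x v) (t * 1)).1,
          t • (tangentLift I (expCurve I x v) (t * 1)).2⟩ := by
      unfold tangentLift
      rw [velocity_rescale ht hc.1.mdifferentiableOn (right_mem_Icc.2 zero_le_one)]
    rwa [mul_one] at this
  have hn : ‖velocity I (fun s => expCurve I x v (t * s)) 0‖ = ‖t • v‖ :=
    congrArg (fun p : TangentBundle I M => ‖p.2‖) e0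
  rw [e0, e1, hq, hq ⟨x, v⟩, hn, ← mul_sub, abs_mul, abs_of_nonneg (sq_nonneg t), norm_smul,
    Real.norm_of_nonneg ht.1] at h2
  refine le_of_mul_le_mul_left (h2.trans_eq ?_) (pow_pos hpos 2)
  ring

/-- Taylor estimate along the geodesic `t ↦ exp_x (t v)` contained in `U`. -/
theorem abs_sub_taylor_expMap_le (hf : ∀ p ∈ U, TwiceDifferentiableAt I f p)
    (hL : HessLipschitzAt I f U L x) (hv : v ∈ expDomain I x)
    (hU : ∀ t ∈ Icc (0 : ℝ) 1, expCurve I x v t ∈ U) :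
    |f (expMap I x v) - f x - ⟪grad I f x, v⟫_ℝ - 1 / 2 * ⟪hess I f x v, v⟫_ℝ|
        ≤ L / 6 * ‖v‖ ^ 3 := by
  have hc := isGeodesicFrom_expCurve hv
  have e0 : tangentLift I (expCurve I x v) 0 = ⟨x, v⟩ := hc.2
  have d0 := fun t (ht : t ∈ Icc (0 : ℝ) 1) => hf _ (hU t ht)
  have d1 := fun t (ht : t ∈ Icc (0 : ℝ) 1) => hasDerivWithinAt_comp_curve
    (hc.1.mdifferentiableOn t ht) (d0 t ht).1.self_of_nhds
  have d2 := fun t (ht : t ∈ Icc (0 : ℝ) 1) => hc.1.hasDerivWithinAt_inner_grad ht (d0 t ht)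
  have d3 : ∀ t ∈ Icc (0 : ℝ) 1, |hessQuad I f (tangentLift I (expCurve I x v) t) -
      hessQuad I f (tangentLift I (expCurve I x v) 0)| ≤ L * ‖v‖ ^ 3 * t := fun t ht =>
    e0 ▸ abs_hessQuad_expCurve_sub_le hL hv hU ht
  have h := abs_sub_taylor_two_le d1 d2 d3
  have f1 : expCurve I x v 1 = expMap I x v := congrArg (expMap I x) (one_smul ℝ v)
  rw [f1] at h
  -- The initial point and velocity must be replaced together, as `v` lives in the fibre over `x`.
  have key : ∀ p : TangentBundle I M, p = ⟨x, v⟩ →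
      |f (expMap I x v) - f p.1 - ⟪grad I f p.1, p.2⟫_ℝ - 1 / 2 * hessQuad I f p| ≤
        L * ‖v‖ ^ 3 / 6 →
      |f (expMap I x v) - f x - ⟪grad I f x, v⟫_ℝ - 1 / 2 * ⟪hess I f x v, v⟫_ℝ|
        ≤ L * ‖v‖ ^ 3 / 6 := by
    rintro p rfl hp
    exact hp
  exact (key _ e0 h).trans_eq (by ring)

end TaylorEstimate

end RiemTaylor

end

open RiemTaylor in
theorem theorem2p4
    {E : Type*} [NormedAddCommGroup E] [NormedSpace ℝ E] [CompleteSpace E]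
    {H : Type*} [TopologicalSpace H] (I : ModelWithCorners ℝ E H) [I.Boundaryless]
    {M : Type*} [TopologicalSpace M] [T2Space M] [ChartedSpace H M] [IsManifold I ∞ M]
    [RiemannianBundle (fun x : M => TangentSpace I x)]
    [IsContMDiffRiemannianBundle I ∞ E (fun x : M => TangentSpace I x)]
    (U : Set M) (f : M → ℝ) (hf : ∀ p ∈ U, TwiceDifferentiableAt I f p)
    (L : ℝ) (x : M) (hx : x ∈ U) (hL : HessLipschitzAt I f U L x) :
    (∀ v ∈ expDomain I x, (∀ t ∈ Icc (0 : ℝ) 1, expMap I x (t • v) ∈ U) →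
      |f (expMap I x v) - f x - ⟪grad I f x, v⟫_ℝ - 1 / 2 * ⟪hess I f x v, v⟫_ℝ|
        ≤ L / 6 * ‖v‖ ^ 3) ∧
    (IsGeodesicallyConvex I U → ∀ v ∈ expDomain I x, expMap I x v ∈ U →
      |f (expMap I x v) - f x - ⟪grad I f x, v⟫_ℝ - 1 / 2 * ⟪hess I f x v, v⟫_ℝ|
        ≤ L / 6 * ‖v‖ ^ 3) :=
  ⟨fun _ hv hU => abs_sub_taylor_expMap_le hf hL hv hU,
    fun hconv v hv hvU => abs_sub_taylor_expMap_le hf hL hv (hconv x hx v hv hvU)⟩
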